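/- Let $k$ be an algebraically closed field. **Setting.** A *weak ditalgebra with layer $(R,W_0\oplus W_1)$* is a pair $(T,\delta)$ in which $T=\bigoplus_{n\ge 0}T_n$ is a graded $k$-algebra, $R\subseteq T_0$ is a subalgebra, $W_0\subseteq T_0$ and $W_1\subseteq T_1$ are $R$-$R$-subbimodules, $T$ is freely generated by $R$ and the bimodule $W_0\oplus W_1$ (that is, $T$ is the tensor algebra $T_R(W_0\oplus W_1)$), and $\delta:T\to T$ is a $k$-linear map of degree $1$ with $\delta(ab)=\delta(a)b+(-1)^{|a|}a\,\delta(b)$ for homogeneous $a,b$ and $\delta(R)=0$. Put $A=T_0$ and $V=T_1$. For a two-sided ideal $I$ of $A$ with $\delta(I)\subseteq IV+VI$, the weak ditalgebra is *interlaced with $I$* if $\delta^2(A)\subseteq IV^2+VIV+V^2I$ and $\delta^2(V)\subseteq IV^3+VIV^2+V^2IV+V^3I$. The layer is *triangular* if there are filtrations by $R$-$R$-subbimodules $0=W_0^0\subseteq\dots\subseteq W_0^r=W_0$ and $0=W_1^0\subseteq\dots\subseteq W_1^s=W_1$ such that $\delta(W_0^{i+1})\subseteq A_iW_1A_i$ for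 $0\le i<r$, where $A_i$ is the subalgebra generated by $R$ and $W_0^i$, and $\delta(W_1^{i+1})\subseteq AW_1^iAW_1^iA$ for $0\le i<s$. The ideal $I$ is *triangular* if there are $k$-subspaces $0=H_0\subseteq\dots\subseteq H_t=I$ with $\delta(H_{i+1})\subseteq AH_iV+VH_iA$ for $0\le i<t$. A *special interlaced weak ditalgebra* $\mathcal A=((T,\delta),I)$ is a weak ditalgebra with layer, interlaced with $I$, such that the layer and $I$ are triangular, $R\cong k\times\dots\times k$ (finitely many factors), $W_0$ and $W_1$ are finite dimensional, and $\underline A:=A/I$ is finite dimensional. The category $\mathcal A\text{-mod}$ has as objects the finitely generated $\underline A$-modules. A morphism $M\to N$ is a pair $f=(f^0,f^1)$ with $f^0\in\operatorname{Hom}_k(M,N)$ and $f^1\in\operatorname{Hom}_{A\text{-}A}(V,\operatorname{Hom}_k(M,N))$ such that $a f^0(m)=f^0(am)+f^1(\delta(a))(m)$ for $a\in A$, $m\in M$. The composition of $f:M\to N$ and $g:N\to L$ is $gf=(g^0f^0,(gf)^1)$ with $(gf)^1(v)=g^0f^1(v)+g^1(v)f^0+(g^1*f^1)(\delta(v))$,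 where $g^1*f^1$ is the map on $V\otimes_AV\cong T_2$ with $(g^1*f^1)(uv)=g^1(u)f^1(v)$. The exact structure on $\mathcal A\text{-mod}$ consists of the composable pairs $M\to E\to N$ that are isomorphic in $\mathcal A\text{-mod}$ to a pair $M'\xrightarrow{(\varphi^0,0)}E'\xrightarrow{(\psi^0,0)}N'$ for which $0\to M'\xrightarrow{\varphi^0}E'\xrightarrow{\psi^0}N'\to0$ is a split exact sequence of $R$-modules. A functor from $\mathcal A\text{-mod}$ to modules is *exact* if it maps these pairs to short exact sequences. Let $L:\underline A\text{-mod}\to\mathcal A\text{-mod}$ be the functor $M\mapsto M$, $f^0\mapsto(f^0,0)$. The *right algebra* of $\mathcal A$ is $\Gamma=\operatorname{End}_{\mathcal A}(\underline A)^{op}$; it receives the homomorphism $\underline A\cong\operatorname{End}_{\underline A}(\underline A)^{op}\xrightarrow{L}\Gamma$, and thereby it is a $\Gamma$-$\underline A$-bimodule. Finitely generated left modules are denoted by $\text{-mod}$. **Proposition.** Let $\mathcal A$ be a special interlaced weak ditalgebra with right algebra $\Gamma$. Then: 1. The functor $F=\operatorname{Hom}_{\mathcal A}(\underline A,-)$ takes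 values in $\Gamma\text{-mod}$, and $F:\mathcal A\text{-mod}\to\Gamma\text{-mod}$ is full, faithful and exact. 2. The functor $\Gamma\otimes_{\underline A}-$ is exact (on all $\underline A$-modules, so $\Gamma$ is flat as a right $\underline A$-module) and maps $\underline A\text{-mod}$ to $\Gamma\text{-mod}$; and there is an isomorphism $\Gamma\otimes_{\underline A}-\cong\operatorname{Hom}_{\mathcal A}(\underline A,L(-))$ of functors on $\underline A\text{-mod}$. 3. Let $\mathcal I$ be the full subcategory of the $\Gamma$-modules isomorphic to $\Gamma\otimes_{\underline A}N$ for some $N\in\underline A\text{-mod}$. Then $F$ restricts to an equivalence $\mathcal A\text{-mod}\to\mathcal I$, and $\mathcal I$ is closed under extensions. 4. For all $M,N\in\underline A\text{-mod}$, the map $$\operatorname{Ext}^n_{\underline A}(M,N)\to\operatorname{Ext}^n_\Gamma(\Gamma\otimes_{\underline A}M,\Gamma\otimes_{\underline A}N)$$ induced by the exact functor $\Gamma\otimes_{\underline A}-$ is surjective for every $n\ge1$ and bijective for every $n\ge2$. -/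

import Mathlib

universe u

/-- A weak ditalgebra `(T, δ)` over `k` together with a layer `(R, W₀ ⊕ W₁)`: the graded algebra `T`
is freely generated by the algebra `R` and the `R`-`R`-bimodule `W₀ ⊕ W₁`, where `R` and `W₀` sit in
degree `0` and `W₁` in degree `1`, and `δ` is a linear map of degree `1` satisfying the graded
Leibniz rule and vanishing on `R`. -/
structure WeakDitalgebra (k : Type u) [Field k] : Type (u + 1) where
  T : Type u
  [ringT : Ring T]
  [algebraT : Algebra k T]
  deg : ℕ → Submodule k T
  [gradedT : GradedAlgebra deg]
  δ : T →ₗ[k] T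
  δ_mem : ∀ {n : ℕ} {t : T}, t ∈ deg n → δ t ∈ deg (n + 1)
  leibniz : ∀ {m : ℕ} {a : T}, a ∈ deg m → ∀ b : T,
    δ (a * b) = δ a * b + (-1) ^ m * (a * δ b)
  R : Subalgebra k T
  W₀ : Submodule k T
  W₁ : Submodule k T
  R_le : Subalgebra.toSubmodule R ≤ deg 0
  W₀_le : W₀ ≤ deg 0
  W₁_le : W₁ ≤ deg 1
  W₀_mul : ∀ {r w s : T}, r ∈ R → w ∈ W₀ → s ∈ R → r * w * s ∈ W₀
  W₁_mul : ∀ {r w s : T}, r ∈ R → w ∈ W₁ → s ∈ R → r * w * s ∈ W₁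
  δ_R : ∀ {r : T}, r ∈ R → δ r = 0
  free : ∀ (B : Type u) [Ring B] [Algebra k B]
    (φ : R →ₐ[k] B) (ψ₀ : W₀ →ₗ[k] B) (ψ₁ : W₁ →ₗ[k] B),
    (∀ (r s : R) (w : W₀), ψ₀ ⟨r * w * s, W₀_mul r.2 w.2 s.2⟩ = φ r * ψ₀ w * φ s) →
    (∀ (r s : R) (w : W₁), ψ₁ ⟨r * w * s, W₁_mul r.2 w.2 s.2⟩ = φ r * ψ₁ w * φ s) →
    ∃! Φ : T →ₐ[k] B,
      (∀ r : R, Φ r = φ r) ∧ (∀ w : W₀, Φ w = ψ₀ w) ∧ (∀ w : W₁, Φ w = ψ₁ w)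

attribute [instance] WeakDitalgebra.ringT WeakDitalgebra.algebraT WeakDitalgebra.gradedT

namespace WeakDitalgebra

variable {k : Type u} [Field k] (𝒜 : WeakDitalgebra k)

/-- The algebra `A = T₀`. -/
def A : Subalgebra k 𝒜.T := SetLike.GradeZero.subalgebra 𝒜.deg

/-- The underlying `k`-subspace of `A = T₀`. -/
abbrev Asub : Submodule k 𝒜.T := Subalgebra.toSubmodule 𝒜.A

/-- The `A`-`A`-bimodule `V = T₁`. -/
abbrev V : Submodule k 𝒜.T := 𝒜.deg 1

theorem mem_A {a : 𝒜.T} : a ∈ 𝒜.A ↔ a ∈ 𝒜.deg 0 := Iff.rfl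

/-- The left action of `A` on `V`. -/
def lmul (a : 𝒜.A) (v : 𝒜.V) : 𝒜.V :=
  ⟨a * v, by simpa using SetLike.mul_mem_graded (𝒜.mem_A.1 a.2) v.2⟩

/-- The right action of `A` on `V`. -/
def rmul (v : 𝒜.V) (a : 𝒜.A) : 𝒜.V :=
  ⟨v * a, by simpa using SetLike.mul_mem_graded v.2 (𝒜.mem_A.1 a.2)⟩

/-- The differential `δ : A → V`. -/
def δ₀ (a : 𝒜.A) : 𝒜.V := ⟨𝒜.δ a, 𝒜.δ_mem (𝒜.mem_A.1 a.2)⟩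

/-- The differential `δ : V → T₂`. -/
def δ₁ (v : 𝒜.V) : 𝒜.deg 2 := ⟨𝒜.δ v, 𝒜.δ_mem v.2⟩

/-- The product `V × V → T₂`. -/
def mulV (u v : 𝒜.V) : 𝒜.deg 2 := ⟨u * v, SetLike.mul_mem_graded u.2 v.2⟩

/-- The subalgebra of `T` generated by `R` and `W₀`. -/
def gen : Subalgebra k 𝒜.T := Algebra.adjoin k ((𝒜.R : Set 𝒜.T) ∪ (𝒜.W₀ : Set 𝒜.T))

/-- Auxiliary description of the degree `n` part of the free graded algebra. -/
def comp : ℕ → Submodule k 𝒜.T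
  | 0 => Subalgebra.toSubmodule 𝒜.gen
  | n + 1 => comp n * 𝒜.W₁ * Subalgebra.toSubmodule 𝒜.gen

theorem comp_zero_mul_comp_zero : 𝒜.comp 0 * 𝒜.comp 0 ≤ 𝒜.comp 0 :=
  Submodule.mul_le.2 fun _ hx _ hy => mul_mem (S := Subalgebra k 𝒜.T) (s := 𝒜.gen) hx hy

theorem comp_mul_comp (m n : ℕ) : 𝒜.comp m * 𝒜.comp n ≤ 𝒜.comp (m + n) := by
  induction n with
  | zero =>
    cases m with
    | zero => exact 𝒜.comp_zero_mul_comp_zero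
    | succ m =>
      change 𝒜.comp m * 𝒜.W₁ * 𝒜.comp 0 * 𝒜.comp 0 ≤ 𝒜.comp m * 𝒜.W₁ * 𝒜.comp 0
      rw [mul_assoc _ (𝒜.comp 0)]
      exact mul_le_mul' le_rfl 𝒜.comp_zero_mul_comp_zero
  | succ n ih =>
    change 𝒜.comp m * (𝒜.comp n * 𝒜.W₁ * 𝒜.comp 0) ≤ 𝒜.comp (m + n) * 𝒜.W₁ * 𝒜.comp 0
    rw [← mul_assoc, ← mul_assoc]
    exact mul_le_mul' (mul_le_mul' ih le_rfl) le_rfl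

theorem adjoin_le_A :
    𝒜.gen ≤ 𝒜.A :=
  Algebra.adjoin_le (Set.union_subset (fun _ h => 𝒜.R_le h) (fun _ h => 𝒜.W₀_le h))

theorem deg_mul_deg (m n : ℕ) : 𝒜.deg m * 𝒜.deg n ≤ 𝒜.deg (m + n) :=
  Submodule.mul_le.2 fun _ hx _ hy => SetLike.mul_mem_graded hx hy

theorem comp_le_deg (n : ℕ) : 𝒜.comp n ≤ 𝒜.deg n := by
  induction n with
  | zero => exact fun x hx => 𝒜.adjoin_le_A hx
  | succ n ih =>
    have h0 : 𝒜.comp 0 ≤ 𝒜.deg 0 := fun x hx => 𝒜.adjoin_le_A hx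
    refine (mul_le_mul' (mul_le_mul' ih 𝒜.W₁_le) h0).trans ?_
    exact (mul_le_mul' (𝒜.deg_mul_deg n 1) le_rfl).trans (𝒜.deg_mul_deg (n + 1) 0)

theorem R_le_comp {x : 𝒜.T} (hx : x ∈ 𝒜.R) : x ∈ 𝒜.comp 0 :=
  Algebra.subset_adjoin (R := k) (s := (𝒜.R : Set 𝒜.T) ∪ (𝒜.W₀ : Set 𝒜.T)) (Or.inl hx)

theorem W₀_le_comp {x : 𝒜.T} (hx : x ∈ 𝒜.W₀) : x ∈ 𝒜.comp 0 :=
  Algebra.subset_adjoin (R := k) (s := (𝒜.R : Set 𝒜.T) ∪ (𝒜.W₀ : Set 𝒜.T)) (Or.inr hx)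

theorem one_mem_comp : (1 : 𝒜.T) ∈ 𝒜.comp 0 := 𝒜.R_le_comp (one_mem _)

theorem W₁_le_comp {x : 𝒜.T} (hx : x ∈ 𝒜.W₁) : x ∈ 𝒜.comp 1 := by
  have := Submodule.mul_mem_mul (Submodule.mul_mem_mul 𝒜.one_mem_comp hx) 𝒜.one_mem_comp
  rw [one_mul, mul_one] at this
  exact this

theorem iSup_comp : ⨆ n, 𝒜.comp n = ⊤ := by
  have hmul : ∀ x y, x ∈ ⨆ n, 𝒜.comp n → y ∈ ⨆ n, 𝒜.comp n → x * y ∈ ⨆ n, 𝒜.comp n := by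
    have : (⨆ n, 𝒜.comp n) * (⨆ n, 𝒜.comp n) ≤ ⨆ n, 𝒜.comp n := by
      rw [Submodule.iSup_mul]
      refine iSup_le fun m => ?_
      rw [Submodule.mul_iSup]
      exact iSup_le fun n => (𝒜.comp_mul_comp m n).trans (le_iSup 𝒜.comp (m + n))
    exact fun x y hx hy => this (Submodule.mul_mem_mul hx hy)
  let S : Subalgebra k 𝒜.T := Submodule.toSubalgebra (⨆ n, 𝒜.comp n)
    (le_iSup 𝒜.comp 0 𝒜.one_mem_comp) hmul
  have hR : 𝒜.R ≤ S := fun x hx => le_iSup 𝒜.comp 0 (𝒜.R_le_comp hx)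
  have hW0 : 𝒜.W₀ ≤ Subalgebra.toSubmodule S := fun x hx => le_iSup 𝒜.comp 0 (𝒜.W₀_le_comp hx)
  have hW1 : 𝒜.W₁ ≤ Subalgebra.toSubmodule S := fun x hx => le_iSup 𝒜.comp 1 (𝒜.W₁_le_comp hx)
  obtain ⟨Φ, ⟨h1, h2, h3⟩, -⟩ := 𝒜.free S (Subalgebra.inclusion hR) (Submodule.inclusion hW0)
    (Submodule.inclusion hW1) (fun r s w => rfl) (fun r s w => rfl)
  obtain ⟨Ψ, -, hΨ⟩ := 𝒜.free 𝒜.T 𝒜.R.val 𝒜.W₀.subtype 𝒜.W₁.subtype (fun r s w => rfl)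
    (fun r s w => rfl)
  have e1 := hΨ (S.val.comp Φ) ⟨fun r => by simp [h1], fun w => congrArg Subtype.val (h2 w),
    fun w => congrArg Subtype.val (h3 w)⟩
  have e2 := hΨ (AlgHom.id k 𝒜.T) ⟨fun r => rfl, fun w => rfl, fun w => rfl⟩
  refine eq_top_iff.2 fun x _ => ?_
  have h : S.val (Φ x) = x := by
    have := DFunLike.congr_fun (e1.trans e2.symm) x
    simpa using this
  rw [← h]
  exact (Φ x).2

theorem deg_eq_comp (n : ℕ) : 𝒜.deg n = 𝒜.comp n := by
  refine le_antisymm (fun x hx => ?_) (𝒜.comp_le_deg n)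
  have key : ∀ y ∈ ⨆ n, 𝒜.comp n, ((DirectSum.decompose 𝒜.deg y n : 𝒜.deg n) : 𝒜.T) ∈ 𝒜.comp n := by
    intro y hy
    induction hy using Submodule.iSup_induction' with
    | mem m y hy =>
      by_cases hmn : m = n
      · subst hmn
        rwa [DirectSum.decompose_of_mem_same _ (𝒜.comp_le_deg m hy)]
      · rw [DirectSum.decompose_of_mem_ne _ (𝒜.comp_le_deg m hy) hmn]
        exact zero_mem _
    | zero => simp
    | add y z _ _ hy hz => simpa using add_mem hy hz
  have := key x (by rw [𝒜.iSup_comp]; trivial)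
  rwa [DirectSum.decompose_of_mem_same _ hx] at this

/-- `T` is the tensor algebra of the `A`-`A`-bimodule `V`: universal property. -/
theorem exists_extend {B : Type u} [Ring B] [Algebra k B] (ρ : 𝒜.A →ₐ[k] B) (F : 𝒜.V →ₗ[k] B)
    (hl : ∀ a v, F (𝒜.lmul a v) = ρ a * F v) (hr : ∀ v a, F (𝒜.rmul v a) = F v * ρ a) :
    ∃ Φ : 𝒜.T →ₐ[k] B, (∀ a : 𝒜.A, Φ a = ρ a) ∧ ∀ v : 𝒜.V, Φ v = F v := by
  have hR : 𝒜.R ≤ 𝒜.A := fun x hx => 𝒜.R_le hx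
  let i0 : 𝒜.W₀ →ₗ[k] 𝒜.A :=
    { toFun := fun w => ⟨w, 𝒜.W₀_le w.2⟩, map_add' := fun _ _ => rfl, map_smul' := fun _ _ => rfl }
  obtain ⟨Φ, ⟨h1, h2, h3⟩, -⟩ := 𝒜.free B (ρ.comp (Subalgebra.inclusion hR))
    (ρ.toLinearMap ∘ₗ i0) (F ∘ₗ Submodule.inclusion 𝒜.W₁_le)
    (fun r s w => by
      change ρ (Subalgebra.inclusion hR r * i0 w * Subalgebra.inclusion hR s) = _
      rw [map_mul, map_mul]
      rfl)
    (fun r s w => by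
      have : Submodule.inclusion 𝒜.W₁_le ⟨r * w * s, 𝒜.W₁_mul r.2 w.2 s.2⟩ =
        𝒜.rmul (𝒜.lmul (Subalgebra.inclusion hR r) (Submodule.inclusion 𝒜.W₁_le w))
          (Subalgebra.inclusion hR s) := rfl
      simp only [LinearMap.comp_apply, AlgHom.comp_apply]
      rw [this, hr, hl])
  have hA : ∀ a : 𝒜.A, Φ a = ρ a := by
    rintro ⟨a, ha⟩
    have ha' : a ∈ Algebra.adjoin k ((𝒜.R : Set 𝒜.T) ∪ (𝒜.W₀ : Set 𝒜.T)) :=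
      (𝒜.deg_eq_comp 0).le ha
    induction ha' using Algebra.adjoin_induction with
    | mem x hx =>
      rcases hx with hx | hx
      · exact h1 ⟨x, hx⟩
      · exact h2 ⟨x, hx⟩
    | algebraMap r =>
      have : (⟨algebraMap k 𝒜.T r, ha⟩ : 𝒜.A) = algebraMap k 𝒜.A r := rfl
      rw [this, AlgHom.commutes]
      exact Φ.commutes r
    | add x y hx hy ihx ihy =>
      have : (⟨x + y, ha⟩ : 𝒜.A) = ⟨x, 𝒜.adjoin_le_A hx⟩ + ⟨y, 𝒜.adjoin_le_A hy⟩ := rfl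
      rw [this, map_add, ← ihx, ← ihy]
      exact map_add Φ x y
    | mul x y hx hy ihx ihy =>
      have : (⟨x * y, ha⟩ : 𝒜.A) = ⟨x, 𝒜.adjoin_le_A hx⟩ * ⟨y, 𝒜.adjoin_le_A hy⟩ := rfl
      rw [this, map_mul, ← ihx, ← ihy]
      exact map_mul Φ x y
  refine ⟨Φ, hA, ?_⟩
  have hspan : 𝒜.V ≤ Submodule.map 𝒜.V.subtype (LinearMap.eqLocus (Φ.toLinearMap ∘ₗ 𝒜.V.subtype) F) := by
    refine (𝒜.deg_eq_comp 1).le.trans ?_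
    change 𝒜.comp 0 * 𝒜.W₁ * 𝒜.comp 0 ≤ _
    rw [Submodule.mul_le]
    intro x hx b hb
    refine Submodule.mul_induction_on hx (fun a ha w hw => ?_) (fun x y hx hy => ?_)
    · have ha' : a ∈ 𝒜.A := 𝒜.comp_le_deg 0 ha
      have hb' : b ∈ 𝒜.A := 𝒜.comp_le_deg 0 hb
      refine ⟨𝒜.rmul (𝒜.lmul ⟨a, ha'⟩ ⟨w, 𝒜.W₁_le hw⟩) ⟨b, hb'⟩, ?_, rfl⟩
      have e : Φ w = F ⟨w, 𝒜.W₁_le hw⟩ := h3 ⟨w, hw⟩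
      change Φ (a * w * b) = F _
      rw [hr, hl, map_mul, map_mul, ← e, ← hA, ← hA]
    · rw [add_mul]
      exact add_mem hx hy
  rintro ⟨v, hv⟩
  obtain ⟨w, hw, hwv⟩ := hspan hv
  have : w = ⟨v, hv⟩ := Subtype.ext hwv
  subst this
  exact hw

theorem deg_two_le : 𝒜.deg 2 ≤ 𝒜.V * 𝒜.V := by
  rw [𝒜.deg_eq_comp 2]
  change 𝒜.comp 1 * 𝒜.W₁ * 𝒜.comp 0 ≤ _
  rw [mul_assoc, V, 𝒜.deg_eq_comp 1]
  refine mul_le_mul' le_rfl ?_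
  refine (mul_le_mul' (fun x hx => 𝒜.W₁_le_comp hx) le_rfl).trans (𝒜.comp_mul_comp 1 0)

/-- `T₂` is spanned by the products of two elements of `V`. -/
theorem deg_two_ext {X : Type u} [AddCommGroup X] [Module k X] {θ θ' : 𝒜.deg 2 →ₗ[k] X}
    (h : ∀ u v : 𝒜.V, θ (𝒜.mulV u v) = θ' (𝒜.mulV u v)) : θ = θ' := by
  have hspan : 𝒜.deg 2 ≤ Submodule.map (𝒜.deg 2).subtype (LinearMap.eqLocus θ θ') := by
    refine 𝒜.deg_two_le.trans (Submodule.mul_le.2 fun u hu v hv => ?_)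
    exact ⟨𝒜.mulV ⟨u, hu⟩ ⟨v, hv⟩, h _ _, rfl⟩
  ext ⟨x, hx⟩
  obtain ⟨w, hw, hwx⟩ := hspan hx
  have : w = ⟨x, hx⟩ := Subtype.ext hwx
  subst this
  exact hw

end WeakDitalgebra

namespace WeakDitalgebra

variable {k : Type u} [Field k] (𝒜 : WeakDitalgebra k)

section Star

variable {M N L K : Type u} [AddCommGroup M] [AddCommGroup N] [AddCommGroup L] [AddCommGroup K]
  [Module k M] [Module k N] [Module k L] [Module k K]
  [Module 𝒜.A M] [Module 𝒜.A N] [Module 𝒜.A L] [Module 𝒜.A K]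
  [IsScalarTower k 𝒜.A M] [IsScalarTower k 𝒜.A N] [IsScalarTower k 𝒜.A L] [IsScalarTower k 𝒜.A K]

theorem exists_star_aux (g : 𝒜.V →ₗ[k] (N →ₗ[k] L)) (f : 𝒜.V →ₗ[k] (M →ₗ[k] N))
    (hg : ∀ a v n, g (𝒜.lmul a v) n = a • g v n) (hg' : ∀ a v n, g (𝒜.rmul v a) n = g v (a • n))
    (hf : ∀ a v m, f (𝒜.lmul a v) m = a • f v m) (hf' : ∀ a v m, f (𝒜.rmul v a) m = f v (a • m)) :
    ∃ Ψ : 𝒜.T →ₗ[k] (M →ₗ[k] L), ∀ (u v : 𝒜.V) (m : M), Ψ (u * v) m = g u (f v m) := by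
  let F : 𝒜.V →ₗ[k] Module.End k (M × N × L) :=
    { toFun := fun v => LinearMap.prod 0 (LinearMap.prod (f v ∘ₗ LinearMap.fst k M (N × L))
        (g v ∘ₗ LinearMap.fst k N L ∘ₗ LinearMap.snd k M (N × L)))
      map_add' := fun v w => by ext <;> simp
      map_smul' := fun c v => by ext <;> simp }
  have hF : ∀ v x, F v x = (0, f v x.1, g v x.2.1) := fun v x => rfl
  obtain ⟨Φ, -, hΦ⟩ := 𝒜.exists_extend (Algebra.lsmul k k (M × N × L)) F
    (fun a v => LinearMap.ext fun x => by
      rw [Module.End.mul_apply, Algebra.lsmul_coe, hF, hF, hf, hg]; simp)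
    (fun v a => LinearMap.ext fun x => by
      rw [Module.End.mul_apply, Algebra.lsmul_coe, hF, hF, hf', hg']; rfl)
  refine ⟨{ toFun := fun x => (LinearMap.snd k N L ∘ₗ LinearMap.snd k M (N × L)) ∘ₗ
              Φ x ∘ₗ LinearMap.inl k M (N × L)
            map_add' := fun x y => by ext; simp
            map_smul' := fun c x => by ext; simp }, fun u v m => ?_⟩
  change (Φ (u * v) (m, 0)).2.2 = _
  rw [map_mul, hΦ, hΦ, Module.End.mul_apply, hF, hF]

theorem exists_star_aux₃ (h : 𝒜.V →ₗ[k] (L →ₗ[k] K)) (g : 𝒜.V →ₗ[k] (N →ₗ[k] L))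
    (f : 𝒜.V →ₗ[k] (M →ₗ[k] N))
    (hh : ∀ a v n, h (𝒜.lmul a v) n = a • h v n) (hh' : ∀ a v n, h (𝒜.rmul v a) n = h v (a • n))
    (hg : ∀ a v n, g (𝒜.lmul a v) n = a • g v n) (hg' : ∀ a v n, g (𝒜.rmul v a) n = g v (a • n))
    (hf : ∀ a v m, f (𝒜.lmul a v) m = a • f v m) (hf' : ∀ a v m, f (𝒜.rmul v a) m = f v (a • m)) :
    ∃ Ψ : 𝒜.T →ₗ[k] (M →ₗ[k] K), ∀ (u v w : 𝒜.V) (m : M),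
      Ψ (u * v * w) m = h u (g v (f w m)) := by
  let F : 𝒜.V →ₗ[k] Module.End k (M × N × L × K) :=
    { toFun := fun v => LinearMap.prod 0 (LinearMap.prod (f v ∘ₗ LinearMap.fst k M (N × L × K))
        (LinearMap.prod (g v ∘ₗ LinearMap.fst k N (L × K) ∘ₗ LinearMap.snd k M (N × L × K))
          (h v ∘ₗ LinearMap.fst k L K ∘ₗ LinearMap.snd k N (L × K) ∘ₗ
            LinearMap.snd k M (N × L × K))))
      map_add' := fun v w => LinearMap.ext fun x => by simp
      map_smul' := fun c v => LinearMap.ext fun x => by simp }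
  have hF : ∀ v x, F v x = (0, f v x.1, g v x.2.1, h v x.2.2.1) := fun v x => rfl
  obtain ⟨Φ, -, hΦ⟩ := 𝒜.exists_extend (Algebra.lsmul k k (M × N × L × K)) F
    (fun a v => LinearMap.ext fun x => by
      rw [Module.End.mul_apply, Algebra.lsmul_coe, hF, hF, hf, hg, hh]; simp)
    (fun v a => LinearMap.ext fun x => by
      rw [Module.End.mul_apply, Algebra.lsmul_coe, hF, hF, hf', hg', hh']; rfl)
  refine ⟨{ toFun := fun x => (LinearMap.snd k L K ∘ₗ LinearMap.snd k N (L × K) ∘ₗ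
              LinearMap.snd k M (N × L × K)) ∘ₗ Φ x ∘ₗ LinearMap.inl k M (N × L × K)
            map_add' := fun x y => by ext; simp
            map_smul' := fun c x => by ext; simp }, fun u v w m => ?_⟩
  change (Φ (u * v * w) (m, 0)).2.2.2 = _
  rw [map_mul, map_mul, hΦ, hΦ, hΦ, Module.End.mul_apply, Module.End.mul_apply, hF, hF, hF]

end Star

/-- An ideal of `A = T₀`, regarded as a `k`-subspace of `T`. -/
def idealSub (I : Ideal 𝒜.A) : Submodule k 𝒜.T :=
  (I.restrictScalars k).map 𝒜.A.val.toLinearMap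

/-- The weak ditalgebra `𝒜` is interlaced with the ideal `I` of `A = T₀`. -/
structure IsInterlacedWith (I : Ideal 𝒜.A) : Prop where
  twoSided : I.IsTwoSided
  δ_I : (𝒜.idealSub I).map 𝒜.δ ≤ 𝒜.idealSub I * 𝒜.V ⊔ 𝒜.V * 𝒜.idealSub I
  δδ_A : 𝒜.Asub.map (𝒜.δ ∘ₗ 𝒜.δ) ≤
    𝒜.idealSub I * 𝒜.V * 𝒜.V ⊔ 𝒜.V * 𝒜.idealSub I * 𝒜.V ⊔ 𝒜.V * 𝒜.V * 𝒜.idealSub I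
  δδ_V : 𝒜.V.map (𝒜.δ ∘ₗ 𝒜.δ) ≤
    𝒜.idealSub I * 𝒜.V * 𝒜.V * 𝒜.V ⊔ 𝒜.V * 𝒜.idealSub I * 𝒜.V * 𝒜.V ⊔
      𝒜.V * 𝒜.V * 𝒜.idealSub I * 𝒜.V ⊔ 𝒜.V * 𝒜.V * 𝒜.V * 𝒜.idealSub I

/-- The layer `(R, W₀ ⊕ W₁)` of `𝒜` is triangular. -/
structure IsTriangular : Prop where
  exists_filtration_W₀ : ∃ (r : ℕ) (F : ℕ → Submodule k 𝒜.T),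
    F 0 = ⊥ ∧ F r = 𝒜.W₀ ∧ (∀ i < r, F i ≤ F (i + 1)) ∧
    (∀ i ≤ r, ∀ a ∈ 𝒜.R, ∀ w ∈ F i, ∀ b ∈ 𝒜.R, a * w * b ∈ F i) ∧
    ∀ i < r, (F (i + 1)).map 𝒜.δ ≤
      Subalgebra.toSubmodule (Algebra.adjoin k ((𝒜.R : Set 𝒜.T) ∪ (F i : Set 𝒜.T))) * 𝒜.W₁ *
        Subalgebra.toSubmodule (Algebra.adjoin k ((𝒜.R : Set 𝒜.T) ∪ (F i : Set 𝒜.T)))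
  exists_filtration_W₁ : ∃ (s : ℕ) (F : ℕ → Submodule k 𝒜.T),
    F 0 = ⊥ ∧ F s = 𝒜.W₁ ∧ (∀ i < s, F i ≤ F (i + 1)) ∧
    (∀ i ≤ s, ∀ a ∈ 𝒜.R, ∀ w ∈ F i, ∀ b ∈ 𝒜.R, a * w * b ∈ F i) ∧
    ∀ i < s, (F (i + 1)).map 𝒜.δ ≤ 𝒜.Asub * F i * 𝒜.Asub * F i * 𝒜.Asub

/-- The ideal `I` of `A = T₀` is `𝒜`-triangular. -/
def IsTriangularIdeal (I : Ideal 𝒜.A) : Prop :=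
  ∃ (t : ℕ) (H : ℕ → Submodule k 𝒜.T),
    H 0 = ⊥ ∧ H t = 𝒜.idealSub I ∧ (∀ i < t, H i ≤ H (i + 1)) ∧
    ∀ i < t, (H (i + 1)).map 𝒜.δ ≤ 𝒜.Asub * H i * 𝒜.V ⊔ 𝒜.V * H i * 𝒜.Asub

end WeakDitalgebra

/-- An interlaced weak ditalgebra (with a layer): a weak ditalgebra `𝒜` together with an ideal `I`
of `A = T₀` such that `𝒜` is interlaced with `I`. -/
structure InterlacedWeakDitalgebra (k : Type u) [Field k] extends WeakDitalgebra k where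
  I : Ideal toWeakDitalgebra.A
  interlaced : toWeakDitalgebra.IsInterlacedWith I

namespace InterlacedWeakDitalgebra

open WeakDitalgebra CategoryTheory

variable {k : Type u} [Field k] (𝒜 : InterlacedWeakDitalgebra k)

instance twoSided : 𝒜.I.IsTwoSided := 𝒜.interlaced.twoSided

/-- The quotient algebra `A̲ = A/I`. -/
abbrev Abar : Type u := 𝒜.A ⧸ 𝒜.I

/-- The special (triangular) interlaced weak ditalgebras: the layer is triangular, the ideal is
triangular, `R` is a finite product of copies of `k`, `W₀` and `W₁` are finite dimensional, and
`A̲ = A/I` is finite dimensional. -/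
structure IsSpecial : Prop where
  triangular : 𝒜.IsTriangular
  triangular_ideal : 𝒜.IsTriangularIdeal 𝒜.I
  layer_eq : ∃ n : ℕ, Nonempty (𝒜.R ≃ₐ[k] (Fin n → k))
  finite_W₀ : Module.Finite k 𝒜.W₀
  finite_W₁ : Module.Finite k 𝒜.W₁
  finite_Abar : Module.Finite k 𝒜.Abar

/-- The objects of the category `𝒜-mod`: the finitely generated `A`-modules annihilated by `I`,
that is, the finitely generated `A̲`-modules. -/
structure FGMod : Type (u + 1) where
  carrier : Type u
  [addCommGroup : AddCommGroup carrier]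
  [module : Module 𝒜.Abar carrier]
  [finite : Module.Finite 𝒜.Abar carrier]

attribute [instance] FGMod.addCommGroup FGMod.module FGMod.finite

namespace FGMod

variable {𝒜}

instance : CoeSort 𝒜.FGMod (Type u) := ⟨FGMod.carrier⟩

instance (M : 𝒜.FGMod) : Module 𝒜.A M := Module.compHom M (Ideal.Quotient.mk 𝒜.I)

instance (M : 𝒜.FGMod) : Module k M := Module.compHom M (algebraMap k 𝒜.Abar)

theorem A_smul_def {M : 𝒜.FGMod} (a : 𝒜.A) (m : M) : a • m = Ideal.Quotient.mk 𝒜.I a • m := rfl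

instance (M : 𝒜.FGMod) : IsScalarTower k 𝒜.Abar M :=
  ⟨fun c a m => by
    change (c • a) • m = algebraMap k 𝒜.Abar c • (a • m)
    rw [Algebra.smul_def, mul_smul]⟩

instance (M : 𝒜.FGMod) : IsScalarTower k 𝒜.A M :=
  ⟨fun c a m => by
    change (Ideal.Quotient.mk 𝒜.I (c • a)) • m = algebraMap k 𝒜.Abar c • (Ideal.Quotient.mk 𝒜.I a • m)
    rw [← mul_smul, Algebra.smul_def, map_mul]
    rfl⟩

theorem smul_of_mem {M : 𝒜.FGMod} {a : 𝒜.A} (ha : a ∈ 𝒜.I) (m : M) : a • m = 0 := by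
  rw [A_smul_def, Ideal.Quotient.eq_zero_iff_mem.2 ha, zero_smul]

end FGMod

/-- The space `Hom_{A-A}(V, Hom_k(M, N))`. -/
def BimodHom (M N : 𝒜.FGMod) : Submodule k (𝒜.V →ₗ[k] (M →ₗ[k] N)) where
  carrier := {f | (∀ (a : 𝒜.A) (v : 𝒜.V) (m : M), f (𝒜.lmul a v) m = a • f v m) ∧
    ∀ (a : 𝒜.A) (v : 𝒜.V) (m : M), f (𝒜.rmul v a) m = f v (a • m)}
  zero_mem' := by constructor <;> intros <;> simp
  add_mem' := by
    rintro f g ⟨hf, hf'⟩ ⟨hg, hg'⟩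
    constructor <;> intros <;> simp_all
  smul_mem' := by
    rintro c f ⟨hf, hf'⟩
    constructor
    · intro a v m
      simp [hf, smul_algebra_smul_comm]
    · intros; simp_all

variable {𝒜}

/-- There is a well defined map `g * f : V ⊗_A V = T₂ → Hom_k(M, L)` with
`(g * f)(uv) = g(u) f(v)` for `u, v ∈ V`. -/
theorem exists_star {M N L : 𝒜.FGMod} (g : 𝒜.BimodHom N L) (f : 𝒜.BimodHom M N) :
    ∃ θ : 𝒜.deg 2 →ₗ[k] (M →ₗ[k] L), ∀ (u v : 𝒜.V) (m : M),
      θ (𝒜.mulV u v) m = g.1 u (f.1 v m) := by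
  obtain ⟨Ψ, hΨ⟩ := 𝒜.toWeakDitalgebra.exists_star_aux g.1 f.1 g.2.1 g.2.2 f.2.1 f.2.2
  exact ⟨Ψ ∘ₗ (𝒜.deg 2).subtype, hΨ⟩

/-- The map `g * f : V ⊗_A V = T₂ → Hom_k(M, L)` determined by `(g * f)(uv) = g(u) f(v)`. -/
noncomputable def star {M N L : 𝒜.FGMod} (g : 𝒜.BimodHom N L) (f : 𝒜.BimodHom M N) :
    𝒜.deg 2 →ₗ[k] (M →ₗ[k] L) := (exists_star g f).choose

@[simp]
theorem star_mulV {M N L : 𝒜.FGMod} (g : 𝒜.BimodHom N L) (f : 𝒜.BimodHom M N) (u v : 𝒜.V)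
    (m : M) : star g f (𝒜.mulV u v) m = g.1 u (f.1 v m) := (exists_star g f).choose_spec u v m

theorem eq_star {M N L : 𝒜.FGMod} {g : 𝒜.BimodHom N L} {f : 𝒜.BimodHom M N}
    {θ : 𝒜.deg 2 →ₗ[k] (M →ₗ[k] L)} (h : ∀ u v m, θ (𝒜.mulV u v) m = g.1 u (f.1 v m)) :
    θ = star g f :=
  𝒜.deg_two_ext fun u v => LinearMap.ext fun m => by rw [h, star_mulV]

/-- The morphisms of `𝒜-mod`: the pairs `(f⁰, f¹)` with `f⁰ ∈ Hom_k(M, N)`,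
`f¹ ∈ Hom_{A-A}(V, Hom_k(M, N))` and `a f⁰(m) = f⁰(a m) + f¹(δ(a))(m)`. -/
@[ext]
structure Hom (M N : 𝒜.FGMod) where
  f0 : M →ₗ[k] N
  f1 : 𝒜.BimodHom M N
  comm : ∀ (a : 𝒜.A) (m : M), a • f0 m = f0 (a • m) + f1.1 (𝒜.δ₀ a) m

namespace Hom

variable {M N : 𝒜.FGMod}

theorem ext' {f g : Hom M N} (h0 : ∀ m, f.f0 m = g.f0 m) (h1 : ∀ v m, f.f1.1 v m = g.f1.1 v m) :
    f = g :=
  Hom.ext (LinearMap.ext h0) (Subtype.ext (LinearMap.ext fun v => LinearMap.ext fun m => h1 v m))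

instance : Zero (Hom M N) := ⟨⟨0, 0, fun a m => by simp⟩⟩

instance : Add (Hom M N) := ⟨fun f g => ⟨f.f0 + g.f0, f.f1 + g.f1, fun a m => by
  have h1 := f.comm a m
  have h2 := g.comm a m
  simp [h1, h2]
  abel⟩⟩

instance : SMul k (Hom M N) := ⟨fun c f => ⟨c • f.f0, c • f.f1, fun a m => by
  have h1 := f.comm a m
  simp [smul_algebra_smul_comm, h1]⟩⟩

instance : Neg (Hom M N) := ⟨fun f => ⟨-f.f0, -f.f1, fun a m => by
  have h1 := f.comm a m
  simp [h1]
  abel⟩⟩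

instance : AddCommGroup (Hom M N) where
  add_assoc _ _ _ := Hom.ext (add_assoc _ _ _) (add_assoc _ _ _)
  zero_add _ := Hom.ext (zero_add _) (zero_add _)
  add_zero _ := Hom.ext (add_zero _) (add_zero _)
  add_comm _ _ := Hom.ext (add_comm _ _) (add_comm _ _)
  nsmul := nsmulRec
  zsmul := zsmulRec
  neg_add_cancel f := ext' (fun m => neg_add_cancel (f.f0 m)) (fun v m => neg_add_cancel (f.f1.1 v m))

instance : Module k (Hom M N) where
  one_smul _ := Hom.ext (one_smul _ _) (one_smul _ _)
  mul_smul _ _ _ := Hom.ext (mul_smul _ _ _) (mul_smul _ _ _)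
  smul_zero _ := Hom.ext (smul_zero _) (smul_zero _)
  smul_add _ _ _ := Hom.ext (smul_add _ _ _) (smul_add _ _ _)
  add_smul _ _ _ := Hom.ext (add_smul _ _ _) (add_smul _ _ _)
  zero_smul f := ext' (fun m => zero_smul k (f.f0 m)) (fun v m => zero_smul k (f.f1.1 v m))

end Hom

end InterlacedWeakDitalgebra

namespace InterlacedWeakDitalgebra

open WeakDitalgebra CategoryTheory

variable {k : Type u} [Field k] {𝒜 : InterlacedWeakDitalgebra k}

theorem mem_idealSub {x : 𝒜.T} (hx : x ∈ 𝒜.idealSub 𝒜.I) : ∃ i : 𝒜.A, i ∈ 𝒜.I ∧ (i : 𝒜.T) = x := hx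

theorem star_δδ {M N L : 𝒜.FGMod} (g : 𝒜.BimodHom N L) (f : 𝒜.BimodHom M N) (a : 𝒜.A) :
    star g f (𝒜.δ₁ (𝒜.δ₀ a)) = 0 := by
  obtain ⟨Ψ, hΨ⟩ := 𝒜.toWeakDitalgebra.exists_star_aux g.1 f.1 g.2.1 g.2.2 f.2.1 f.2.2
  have e : Ψ ∘ₗ (𝒜.deg 2).subtype = star g f := eq_star hΨ
  rw [← e]
  have hle : 𝒜.idealSub 𝒜.I * 𝒜.V * 𝒜.V ⊔ 𝒜.V * 𝒜.idealSub 𝒜.I * 𝒜.V ⊔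
      𝒜.V * 𝒜.V * 𝒜.idealSub 𝒜.I ≤ LinearMap.ker Ψ := by
    refine sup_le (sup_le ?_ ?_) ?_
    · refine Submodule.mul_le.2 fun x hx v hv => ?_
      refine Submodule.mul_induction_on hx (fun i hi u hu => ?_) (fun x y hx hy => ?_)
      · obtain ⟨j, hj, rfl⟩ := mem_idealSub hi
        ext m
        refine (hΨ (𝒜.lmul j ⟨u, hu⟩) ⟨v, hv⟩ m).trans ?_
        rw [g.2.1, FGMod.smul_of_mem hj]; rfl
      · rw [add_mul]; exact add_mem hx hy
    · refine Submodule.mul_le.2 fun x hx v hv => ?_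
      refine Submodule.mul_induction_on hx (fun u hu i hi => ?_) (fun x y hx hy => ?_)
      · obtain ⟨j, hj, rfl⟩ := mem_idealSub hi
        ext m
        refine (hΨ (𝒜.rmul ⟨u, hu⟩ j) ⟨v, hv⟩ m).trans ?_
        rw [g.2.2, FGMod.smul_of_mem hj, map_zero]; rfl
      · rw [add_mul]; exact add_mem hx hy
    · rw [mul_assoc]
      refine Submodule.mul_le.2 fun u hu x hx => ?_
      refine Submodule.mul_induction_on hx (fun v hv i hi => ?_) (fun x y hx hy => ?_)
      · obtain ⟨j, hj, rfl⟩ := mem_idealSub hi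
        ext m
        refine (hΨ ⟨u, hu⟩ (𝒜.rmul ⟨v, hv⟩ j) m).trans ?_
        rw [f.2.2, FGMod.smul_of_mem hj, map_zero, map_zero]; rfl
      · rw [mul_add]; exact add_mem hx hy
  exact hle (𝒜.interlaced.δδ_A ⟨a, a.2, rfl⟩)

theorem δ₁_lmul (a : 𝒜.A) (v : 𝒜.V) :
    (𝒜.δ₁ (𝒜.lmul a v) : 𝒜.T) = 𝒜.mulV (𝒜.δ₀ a) v + a * 𝒜.δ₁ v := by
  have := 𝒜.leibniz (m := 0) a.2 (v : 𝒜.T)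
  rw [pow_zero, one_mul] at this
  exact this

theorem δ₁_rmul (v : 𝒜.V) (a : 𝒜.A) :
    (𝒜.δ₁ (𝒜.rmul v a) : 𝒜.T) = 𝒜.δ₁ v * a - 𝒜.mulV v (𝒜.δ₀ a) := by
  have := 𝒜.leibniz (m := 1) v.2 (a : 𝒜.T)
  rw [pow_one, neg_one_mul, ← sub_eq_add_neg] at this
  exact this

theorem star_lmul {M N L : 𝒜.FGMod} (g : 𝒜.BimodHom N L) (f : 𝒜.BimodHom M N) (a : 𝒜.A)
    (x y : 𝒜.deg 2) (h : (y : 𝒜.T) = a * x) (m : M) : star g f y m = a • star g f x m := by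
  obtain ⟨Ψ, hΨ⟩ := 𝒜.toWeakDitalgebra.exists_star_aux g.1 f.1 g.2.1 g.2.2 f.2.1 f.2.2
  have e : Ψ ∘ₗ (𝒜.deg 2).subtype = star g f := eq_star hΨ
  have : (Ψ ∘ₗ LinearMap.mulLeft k (a : 𝒜.T)) ∘ₗ (𝒜.deg 2).subtype =
      (LinearMap.compRight k (Algebra.lsmul k k L a)) ∘ₗ star g f := by
    refine 𝒜.deg_two_ext fun u v => LinearMap.ext fun m => ?_
    change Ψ (a * (u * v)) m = a • star g f (𝒜.mulV u v) m
    rw [star_mulV, ← mul_assoc, ← g.2.1]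
    exact hΨ (𝒜.lmul a u) v m
  have h2 := LinearMap.congr_fun (LinearMap.congr_fun this x) m
  rw [← e]
  change Ψ (y : 𝒜.T) m = _
  rw [h]
  refine h2.trans ?_
  rw [← e]
  rfl

theorem star_rmul {M N L : 𝒜.FGMod} (g : 𝒜.BimodHom N L) (f : 𝒜.BimodHom M N) (a : 𝒜.A)
    (x y : 𝒜.deg 2) (h : (y : 𝒜.T) = x * a) (m : M) : star g f y m = star g f x (a • m) := by
  obtain ⟨Ψ, hΨ⟩ := 𝒜.toWeakDitalgebra.exists_star_aux g.1 f.1 g.2.1 g.2.2 f.2.1 f.2.2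
  have e : Ψ ∘ₗ (𝒜.deg 2).subtype = star g f := eq_star hΨ
  have : (Ψ ∘ₗ LinearMap.mulRight k (a : 𝒜.T)) ∘ₗ (𝒜.deg 2).subtype =
      (LinearMap.lcomp k L (Algebra.lsmul k k M a)) ∘ₗ star g f := by
    refine 𝒜.deg_two_ext fun u v => LinearMap.ext fun m => ?_
    change Ψ (u * v * a) m = star g f (𝒜.mulV u v) (a • m)
    rw [star_mulV, mul_assoc, ← f.2.2]
    exact hΨ u (𝒜.rmul v a) m
  have h2 := LinearMap.congr_fun (LinearMap.congr_fun this x) m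
  rw [← e]
  change Ψ (y : 𝒜.T) m = _
  rw [h]
  refine h2.trans ?_
  rw [← e]
  rfl

theorem mul_mem_two {a : 𝒜.A} {x : 𝒜.deg 2} : (a * x : 𝒜.T) ∈ 𝒜.deg 2 := by
  have := SetLike.mul_mem_graded (𝒜.mem_A.1 a.2) x.2
  rwa [zero_add] at this

theorem mem_two_mul {a : 𝒜.A} {x : 𝒜.deg 2} : (x * a : 𝒜.T) ∈ 𝒜.deg 2 := by
  have := SetLike.mul_mem_graded x.2 (𝒜.mem_A.1 a.2)
  rwa [add_zero] at this

namespace Hom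

/-- The second component `(gf)¹` of a composition, as a linear map on `V`:
`(gf)¹(v) = g⁰ f¹(v) + g¹(v) f⁰ + (g¹ * f¹)(δ(v))`. -/
noncomputable def comp₁ {M N L : 𝒜.FGMod} (g : Hom N L) (f : Hom M N) :
    𝒜.V →ₗ[k] (M →ₗ[k] L) where
  toFun v := g.f0 ∘ₗ f.f1.1 v + g.f1.1 v ∘ₗ f.f0 + star g.f1 f.f1 (𝒜.δ₁ v)
  map_add' v w := by
    have : 𝒜.δ₁ (v + w) = 𝒜.δ₁ v + 𝒜.δ₁ w := Subtype.ext (map_add 𝒜.δ _ _)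
    ext m
    simp only [this, map_add, LinearMap.add_apply, LinearMap.comp_apply]
    abel
  map_smul' c v := by
    have : 𝒜.δ₁ (c • v) = c • 𝒜.δ₁ v := Subtype.ext (map_smul 𝒜.δ _ _)
    ext m
    simp only [this, map_smul, LinearMap.add_apply, LinearMap.comp_apply,
      LinearMap.smul_apply, smul_add, RingHom.id_apply]

theorem comp₁_apply {M N L : 𝒜.FGMod} (g : Hom N L) (f : Hom M N) (v : 𝒜.V) (m : M) :
    comp₁ g f v m = g.f0 (f.f1.1 v m) + g.f1.1 v (f.f0 m) + star g.f1 f.f1 (𝒜.δ₁ v) m := rfl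

theorem comp₁_lmul {M N L : 𝒜.FGMod} (g : Hom N L) (f : Hom M N) (a : 𝒜.A) (v : 𝒜.V) (m : M) :
    comp₁ g f (𝒜.lmul a v) m = a • comp₁ g f v m := by
  have e : 𝒜.δ₁ (𝒜.lmul a v) = 𝒜.mulV (𝒜.δ₀ a) v + ⟨a * 𝒜.δ₁ v, mul_mem_two⟩ :=
    Subtype.ext (δ₁_lmul a v)
  rw [comp₁_apply, comp₁_apply, e, map_add, LinearMap.add_apply, star_mulV,
    star_lmul _ _ a (𝒜.δ₁ v) _ rfl, f.f1.2.1, g.f1.2.1, smul_add, smul_add, g.comm]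
  abel

theorem comp₁_rmul {M N L : 𝒜.FGMod} (g : Hom N L) (f : Hom M N) (a : 𝒜.A) (v : 𝒜.V) (m : M) :
    comp₁ g f (𝒜.rmul v a) m = comp₁ g f v (a • m) := by
  have e : 𝒜.δ₁ (𝒜.rmul v a) = ⟨𝒜.δ₁ v * a, mem_two_mul⟩ - 𝒜.mulV v (𝒜.δ₀ a) :=
    Subtype.ext (δ₁_rmul v a)
  have e2 : f.f0 (a • m) = a • f.f0 m - f.f1.1 (𝒜.δ₀ a) m := by rw [f.comm, add_sub_cancel_right]
  rw [comp₁_apply, comp₁_apply, e, map_sub, LinearMap.sub_apply, star_mulV,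
    star_rmul _ _ a (𝒜.δ₁ v) _ rfl, f.f1.2.2, g.f1.2.2, e2, map_sub]
  abel

/-- The composition `gf = (g⁰f⁰, (gf)¹)` in `𝒜-mod`, where
`(gf)¹(v) = g⁰ f¹(v) + g¹(v) f⁰ + (g¹ * f¹)(δ(v))`. -/
noncomputable def comp {M N L : 𝒜.FGMod} (g : Hom N L) (f : Hom M N) : Hom M L where
  f0 := g.f0 ∘ₗ f.f0
  f1 := ⟨comp₁ g f, comp₁_lmul g f, comp₁_rmul g f⟩
  comm a m := by
    change a • g.f0 (f.f0 m) = g.f0 (f.f0 (a • m)) + comp₁ g f (𝒜.δ₀ a) m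
    rw [comp₁_apply, star_δδ, g.comm, f.comm, map_add, LinearMap.zero_apply]
    abel

/-- The identity `(id, 0)` in `𝒜-mod`. -/
def id (M : 𝒜.FGMod) : Hom M M := ⟨LinearMap.id, 0, fun a m => by simp⟩

end Hom

theorem star_add_left {M N L : 𝒜.FGMod} (g g' : 𝒜.BimodHom N L) (f : 𝒜.BimodHom M N) :
    star (g + g') f = star g f + star g' f :=
  (eq_star fun u v m => by simp).symm

theorem star_add_right {M N L : 𝒜.FGMod} (g : 𝒜.BimodHom N L) (f f' : 𝒜.BimodHom M N) :
    star g (f + f') = star g f + star g f' :=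
  (eq_star fun u v m => by simp).symm

theorem star_smul_left {M N L : 𝒜.FGMod} (c : k) (g : 𝒜.BimodHom N L) (f : 𝒜.BimodHom M N) :
    star (c • g) f = c • star g f :=
  (eq_star fun u v m => by simp).symm

theorem star_smul_right {M N L : 𝒜.FGMod} (c : k) (g : 𝒜.BimodHom N L) (f : 𝒜.BimodHom M N) :
    star g (c • f) = c • star g f :=
  (eq_star fun u v m => by simp).symm

theorem star_zero_left {M N L : 𝒜.FGMod} (f : 𝒜.BimodHom M N) :
    star (0 : 𝒜.BimodHom N L) f = 0 :=
  (eq_star fun u v m => by simp).symm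

theorem star_zero_right {M N L : 𝒜.FGMod} (g : 𝒜.BimodHom N L) :
    star g (0 : 𝒜.BimodHom M N) = 0 :=
  (eq_star fun u v m => by simp).symm

theorem star_assoc_aux {M N L K : 𝒜.FGMod} (h : Hom L K) (g : Hom N L)
    (f : Hom M N) (v : 𝒜.V) (m : M) :
    star (h.comp g).f1 f.f1 (𝒜.δ₁ v) m + star h.f1 g.f1 (𝒜.δ₁ v) (f.f0 m) =
      star h.f1 (g.comp f).f1 (𝒜.δ₁ v) m + h.f0 (star g.f1 f.f1 (𝒜.δ₁ v) m) := by
  obtain ⟨Ψ, hΨ⟩ := 𝒜.toWeakDitalgebra.exists_star_aux₃ h.f1.1 g.f1.1 f.f1.1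
    h.f1.2.1 h.f1.2.2 g.f1.2.1 g.f1.2.2 f.f1.2.1 f.f1.2.2
  have hl : ∀ (x : 𝒜.deg 2) (w : 𝒜.V) (m : M),
      Ψ (x * w) m = star h.f1 g.f1 x (f.f1.1 w m) := by
    intro x w m
    have : (Ψ ∘ₗ LinearMap.mulRight k (w : 𝒜.T)) ∘ₗ (𝒜.deg 2).subtype =
        (LinearMap.lcomp k K (f.f1.1 w)) ∘ₗ star h.f1 g.f1 := by
      refine 𝒜.deg_two_ext fun u v => LinearMap.ext fun m => ?_
      refine (hΨ u v w m).trans ?_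
      exact (star_mulV _ _ _ _ _).symm
    exact LinearMap.congr_fun (LinearMap.congr_fun this x) m
  have hr : ∀ (x : 𝒜.deg 2) (w : 𝒜.V) (m : M),
      Ψ (w * x) m = h.f1.1 w (star g.f1 f.f1 x m) := by
    intro x w m
    have : (Ψ ∘ₗ LinearMap.mulLeft k (w : 𝒜.T)) ∘ₗ (𝒜.deg 2).subtype =
        (LinearMap.compRight k (h.f1.1 w)) ∘ₗ star g.f1 f.f1 := by
      refine 𝒜.deg_two_ext fun u v => LinearMap.ext fun m => ?_
      change Ψ (w * (u * v)) m = h.f1.1 w (star g.f1 f.f1 (𝒜.mulV u v) m)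
      rw [star_mulV, ← mul_assoc]
      exact hΨ w u v m
    exact LinearMap.congr_fun (LinearMap.congr_fun this x) m
  have hle : 𝒜.idealSub 𝒜.I * 𝒜.V * 𝒜.V * 𝒜.V ⊔ 𝒜.V * 𝒜.idealSub 𝒜.I * 𝒜.V * 𝒜.V ⊔
      𝒜.V * 𝒜.V * 𝒜.idealSub 𝒜.I * 𝒜.V ⊔ 𝒜.V * 𝒜.V * 𝒜.V * 𝒜.idealSub 𝒜.I ≤
        LinearMap.ker Ψ := by
    refine sup_le (sup_le (sup_le ?_ ?_) ?_) ?_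
    · refine Submodule.mul_le.2 fun x hx w hw => ?_
      refine Submodule.mul_induction_on hx (fun y hy v hv => ?_) (fun x y hx hy => ?_)
      · refine Submodule.mul_induction_on hy (fun i hi u hu => ?_) (fun x y hx hy => ?_)
        · obtain ⟨j, hj, rfl⟩ := mem_idealSub hi
          ext m
          refine (hΨ (𝒜.lmul j ⟨u, hu⟩) ⟨v, hv⟩ ⟨w, hw⟩ m).trans ?_
          rw [h.f1.2.1, FGMod.smul_of_mem hj]; rfl
        · rw [add_mul, add_mul]; exact add_mem hx hy
      · rw [add_mul]; exact add_mem hx hy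
    · refine Submodule.mul_le.2 fun x hx w hw => ?_
      refine Submodule.mul_induction_on hx (fun y hy v hv => ?_) (fun x y hx hy => ?_)
      · refine Submodule.mul_induction_on hy (fun u hu i hi => ?_) (fun x y hx hy => ?_)
        · obtain ⟨j, hj, rfl⟩ := mem_idealSub hi
          ext m
          refine (hΨ (𝒜.rmul ⟨u, hu⟩ j) ⟨v, hv⟩ ⟨w, hw⟩ m).trans ?_
          rw [h.f1.2.2, FGMod.smul_of_mem hj, map_zero]; rfl
        · rw [add_mul, add_mul]; exact add_mem hx hy
      · rw [add_mul]; exact add_mem hx hy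
    · refine Submodule.mul_le.2 fun x hx w hw => ?_
      refine Submodule.mul_induction_on hx (fun y hy i hi => ?_) (fun x y hx hy => ?_)
      · obtain ⟨j, hj, rfl⟩ := mem_idealSub hi
        refine Submodule.mul_induction_on hy (fun u hu v hv => ?_) (fun x y hx hy => ?_)
        · ext m
          rw [mul_assoc]
          refine (hΨ ⟨u, hu⟩ ⟨v, hv⟩ (𝒜.lmul j ⟨w, hw⟩) m).trans ?_
          rw [f.f1.2.1, FGMod.smul_of_mem hj, map_zero, map_zero]; rfl
        · rw [add_mul, add_mul]; exact add_mem hx hy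
      · rw [add_mul]; exact add_mem hx hy
    · rw [mul_assoc]
      refine Submodule.mul_le.2 fun x hx y hy => ?_
      refine Submodule.mul_induction_on hx (fun u hu v hv => ?_) (fun x z hx hz => ?_)
      · refine Submodule.mul_induction_on hy (fun w hw i hi => ?_) (fun x z hx hz => ?_)
        · obtain ⟨j, hj, rfl⟩ := mem_idealSub hi
          ext m
          refine (hΨ ⟨u, hu⟩ ⟨v, hv⟩ (𝒜.rmul ⟨w, hw⟩ j) m).trans ?_
          rw [f.f1.2.2, FGMod.smul_of_mem hj, map_zero, map_zero, map_zero]; rfl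
        · rw [mul_add]; exact add_mem hx hz
      · rw [add_mul]; exact add_mem hx hz
  have key : star (h.comp g).f1 f.f1 + (LinearMap.lcomp k K f.f0) ∘ₗ star h.f1 g.f1 =
      star h.f1 (g.comp f).f1 + (LinearMap.compRight k h.f0) ∘ₗ star g.f1 f.f1 +
        (Ψ ∘ₗ 𝒜.δ) ∘ₗ (𝒜.deg 2).subtype := by
    refine 𝒜.deg_two_ext fun u w => LinearMap.ext fun m => ?_
    have hδ : 𝒜.δ (u * w) = 𝒜.δ₁ u * w - u * 𝒜.δ₁ w := by
      have := 𝒜.leibniz (m := 1) u.2 (w : 𝒜.T)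
      rw [pow_one, neg_one_mul, ← sub_eq_add_neg] at this
      exact this
    change star (h.comp g).f1 f.f1 (𝒜.mulV u w) m + star h.f1 g.f1 (𝒜.mulV u w) (f.f0 m) =
      star h.f1 (g.comp f).f1 (𝒜.mulV u w) m + h.f0 (star g.f1 f.f1 (𝒜.mulV u w) m) +
        Ψ (𝒜.δ (u * w)) m
    rw [hδ, map_sub, LinearMap.sub_apply, hl, hr]
    have c1 : ∀ u n, (h.comp g).f1.1 u n =
      h.f0 (g.f1.1 u n) + h.f1.1 u (g.f0 n) + star h.f1 g.f1 (𝒜.δ₁ u) n := fun _ _ => rfl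
    have c2 : ∀ u m, (g.comp f).f1.1 u m =
      g.f0 (f.f1.1 u m) + g.f1.1 u (f.f0 m) + star g.f1 f.f1 (𝒜.δ₁ u) m := fun _ _ => rfl
    rw [star_mulV, star_mulV, star_mulV, star_mulV, c1, c2, map_add, map_add]
    abel
  have h0 : Ψ (𝒜.δ (𝒜.δ v)) = 0 := hle (𝒜.interlaced.δδ_V ⟨v, v.2, rfl⟩)
  have h1 := LinearMap.congr_fun (LinearMap.congr_fun key (𝒜.δ₁ v)) m
  change _ = _ + Ψ (𝒜.δ (𝒜.δ v)) m at h1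
  rw [h0, LinearMap.zero_apply, add_zero] at h1
  exact h1

noncomputable instance : Category.{u} 𝒜.FGMod where
  Hom M N := Hom M N
  id M := Hom.id M
  comp f g := Hom.comp g f
  id_comp {M N} f := Hom.ext' (fun m => rfl) (fun v m => by
    change f.f0 0 + f.f1.1 v m + star f.f1 0 (𝒜.δ₁ v) m = f.f1.1 v m
    rw [star_zero_right, map_zero, LinearMap.zero_apply, LinearMap.zero_apply, zero_add, add_zero])
  comp_id {M N} f := Hom.ext' (fun m => rfl) (fun v m => by
    change f.f1.1 v m + 0 + star 0 f.f1 (𝒜.δ₁ v) m = f.f1.1 v m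
    rw [star_zero_left, LinearMap.zero_apply, LinearMap.zero_apply, add_zero, add_zero])
  assoc {M N L K} f g h := Hom.ext' (fun m => rfl) (fun v m => by
    have := star_assoc_aux h g f v m
    change h.f0 (g.f0 (f.f1.1 v m) + g.f1.1 v (f.f0 m) + star g.f1 f.f1 (𝒜.δ₁ v) m) +
        h.f1.1 v (g.f0 (f.f0 m)) + star h.f1 (g.comp f).f1 (𝒜.δ₁ v) m =
      h.f0 (g.f0 (f.f1.1 v m)) + (h.f0 (g.f1.1 v (f.f0 m)) + h.f1.1 v (g.f0 (f.f0 m)) +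
        star h.f1 g.f1 (𝒜.δ₁ v) (f.f0 m)) + star (h.comp g).f1 f.f1 (𝒜.δ₁ v) m
    rw [map_add, map_add]
    rw [← sub_eq_zero] at this ⊢
    rw [← neg_eq_zero, ← this]
    abel)

noncomputable instance : Preadditive 𝒜.FGMod where
  homGroup M N := inferInstanceAs (AddCommGroup (Hom M N))
  add_comp M N L (f : Hom M N) (f' : Hom M N) (g : Hom N L) :=
    Hom.ext' (fun m => map_add g.f0 _ _) (fun v m => by
      change g.f0 (f.f1.1 v m + f'.f1.1 v m) + g.f1.1 v (f.f0 m + f'.f0 m) +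
        star g.f1 (f.f1 + f'.f1) (𝒜.δ₁ v) m =
          (g.f0 (f.f1.1 v m) + g.f1.1 v (f.f0 m) + star g.f1 f.f1 (𝒜.δ₁ v) m) +
          (g.f0 (f'.f1.1 v m) + g.f1.1 v (f'.f0 m) + star g.f1 f'.f1 (𝒜.δ₁ v) m)
      rw [star_add_right, map_add, map_add, LinearMap.add_apply, LinearMap.add_apply]
      abel)
  comp_add M N L (f : Hom M N) (g : Hom N L) (g' : Hom N L) :=
    Hom.ext' (fun m => rfl) (fun v m => by
      change (g.f0 (f.f1.1 v m) + g'.f0 (f.f1.1 v m)) + (g.f1.1 v (f.f0 m) + g'.f1.1 v (f.f0 m)) +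
        star (g.f1 + g'.f1) f.f1 (𝒜.δ₁ v) m =
          (g.f0 (f.f1.1 v m) + g.f1.1 v (f.f0 m) + star g.f1 f.f1 (𝒜.δ₁ v) m) +
          (g'.f0 (f.f1.1 v m) + g'.f1.1 v (f.f0 m) + star g'.f1 f.f1 (𝒜.δ₁ v) m)
      rw [star_add_left, LinearMap.add_apply, LinearMap.add_apply]
      abel)

noncomputable instance : Linear k 𝒜.FGMod where
  homModule M N := inferInstanceAs (Module k (Hom M N))
  smul_comp M N L c (f : Hom M N) (g : Hom N L) :=
    Hom.ext' (fun m => map_smul g.f0 _ _) (fun v m => by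
      change g.f0 (c • f.f1.1 v m) + g.f1.1 v (c • f.f0 m) + star g.f1 (c • f.f1) (𝒜.δ₁ v) m =
        c • (g.f0 (f.f1.1 v m) + g.f1.1 v (f.f0 m) + star g.f1 f.f1 (𝒜.δ₁ v) m)
      rw [star_smul_right, map_smul, map_smul, LinearMap.smul_apply, LinearMap.smul_apply, smul_add,
        smul_add])
  comp_smul M N L (f : Hom M N) c (g : Hom N L) :=
    Hom.ext' (fun m => rfl) (fun v m => by
      change c • g.f0 (f.f1.1 v m) + c • g.f1.1 v (f.f0 m) + star (c • g.f1) f.f1 (𝒜.δ₁ v) m =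
        c • (g.f0 (f.f1.1 v m) + g.f1.1 v (f.f0 m) + star g.f1 f.f1 (𝒜.δ₁ v) m)
      rw [star_smul_left, LinearMap.smul_apply, LinearMap.smul_apply, smul_add, smul_add])

end InterlacedWeakDitalgebra

section Induced

open CategoryTheory TensorProduct

variable {A B : Type u} [Ring A] [Ring B] (φ : A →+* B)

/-- The relations `b φ(a) ⊗ m = b ⊗ a m` defining `B ⊗_A M` as a quotient of `B ⊗_ℤ M`. -/
def inducedRel (M : Type u) [AddCommGroup M] [Module A M] : Submodule B (B ⊗[ℤ] M) :=
  Submodule.span B {x | ∃ (b : B) (a : A) (m : M), x = (b * φ a) ⊗ₜ[ℤ] m - b ⊗ₜ[ℤ] (a • m)}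

theorem inducedRel_le_comap {M N : Type u} [AddCommGroup M] [Module A M] [AddCommGroup N]
    [Module A N] (f : M →ₗ[A] N) :
    inducedRel φ M ≤ (inducedRel φ N).comap
      (TensorProduct.AlgebraTensorModule.lTensor B B (f.restrictScalars ℤ)) := by
  refine Submodule.span_le.2 ?_
  rintro x ⟨b, a, m, rfl⟩
  refine Submodule.subset_span ⟨b, a, f m, ?_⟩
  simp

/-- The functor `B ⊗_A - : A-Mod ⥤ B-Mod` for a ring homomorphism `A → B` of (noncommutative)
rings. -/
noncomputable def extendScalarsFunctor : ModuleCat.{u} A ⥤ ModuleCat.{u} B where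
  obj M := ModuleCat.of B ((B ⊗[ℤ] M) ⧸ inducedRel φ M)
  map f := ModuleCat.ofHom (Submodule.mapQ _ _
    (TensorProduct.AlgebraTensorModule.lTensor B B (f.hom.restrictScalars ℤ))
    (inducedRel_le_comap φ f.hom))
  map_id M := by
    refine ModuleCat.hom_ext (LinearMap.ext fun x => ?_)
    obtain ⟨x, rfl⟩ := Submodule.Quotient.mk_surjective _ x
    change Submodule.Quotient.mk (p := inducedRel φ M) _ = _
    congr 1
    induction x with
    | zero => rfl
    | tmul b m => rfl
    | add x y hx hy => rw [map_add, hx, hy]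
  map_comp {M N L} f g := by
    refine ModuleCat.hom_ext (LinearMap.ext fun x => ?_)
    obtain ⟨x, rfl⟩ := Submodule.Quotient.mk_surjective _ x
    change Submodule.Quotient.mk (p := inducedRel φ L) _ = Submodule.Quotient.mk (p := inducedRel φ L) _
    congr 1
    induction x with
    | zero => simp
    | tmul b m => rfl
    | add x y hx hy => simp only [map_add, hx, hy]

instance : (extendScalarsFunctor φ).Additive where
  map_add {M N f g} := by
    refine ModuleCat.hom_ext (LinearMap.ext fun x => ?_)
    obtain ⟨x, rfl⟩ := Submodule.Quotient.mk_surjective _ x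
    change Submodule.Quotient.mk (p := inducedRel φ N) _ = Submodule.Quotient.mk (p := inducedRel φ N) _ +
      Submodule.Quotient.mk (p := inducedRel φ N) _
    rw [← Submodule.Quotient.mk_add]
    congr 1
    induction x with
    | zero => simp
    | tmul b m =>
      change b ⊗ₜ[ℤ] (f.hom m + g.hom m) = b ⊗ₜ[ℤ] (f.hom m) + b ⊗ₜ[ℤ] (g.hom m)
      rw [TensorProduct.tmul_add]
    | add x y hx hy =>
      rw [map_add, map_add, map_add, hx, hy]
      abel

end Induced

namespace InterlacedWeakDitalgebra

open WeakDitalgebra CategoryTheory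

variable {k : Type u} [Field k] {𝒜 : InterlacedWeakDitalgebra k}

/-- The morphism `(f⁰, 0)` of `𝒜-mod` given by a morphism `f⁰` of `A̲`-modules. -/
def ofLinear {M N : 𝒜.FGMod} (f : M →ₗ[𝒜.Abar] N) : M ⟶ N :=
  (⟨f.restrictScalars k, 0, fun a m => by
    rw [FGMod.A_smul_def, FGMod.A_smul_def]
    simp⟩ : Hom M N)

theorem ofLinear_comp {M N L : 𝒜.FGMod} (f : M →ₗ[𝒜.Abar] N) (g : N →ₗ[𝒜.Abar] L) :
    ofLinear (g ∘ₗ f) = ofLinear f ≫ ofLinear g :=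
  Hom.ext' (fun m => rfl) (fun v m => by
    change 0 = g 0 + 0 + star (0 : 𝒜.BimodHom N L) (0 : 𝒜.BimodHom M N) (𝒜.δ₁ v) m
    rw [star_zero_left, map_zero, LinearMap.zero_apply, LinearMap.zero_apply, add_zero, add_zero])

variable (𝒜)

/-- The embedding `L : A̲-mod ⥤ 𝒜-mod`, `M ↦ M`, `f⁰ ↦ (f⁰, 0)`. -/
def L : FGModuleCat.{u} 𝒜.Abar ⥤ 𝒜.FGMod where
  obj M := ⟨M⟩
  map f := ofLinear f.hom.hom
  map_id _ := rfl
  map_comp {M N K} f g :=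
    ofLinear_comp (M := FGMod.mk M) (N := FGMod.mk N) (L := FGMod.mk K) f.hom.hom g.hom.hom

/-- The regular module `A̲` as an object of `𝒜-mod`. -/
def regular : 𝒜.FGMod := ⟨𝒜.Abar⟩

/-- The right algebra `Γ = End_𝒜(A̲)ᵒᵖ`. -/
abbrev Γ : Type u := (End 𝒜.regular)ᵐᵒᵖ

/-- The embedding `A̲ ≅ End_{A̲}(A̲)ᵒᵖ → End_𝒜(A̲)ᵒᵖ = Γ`, sending `a` to the right multiplication
by `a`. -/
def toΓ : 𝒜.Abar →+* 𝒜.Γ where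
  toFun a := MulOpposite.op (ofLinear (M := 𝒜.regular) (N := 𝒜.regular)
    (LinearMap.toSpanSingleton 𝒜.Abar 𝒜.Abar a))
  map_one' := congrArg MulOpposite.op (Hom.ext' (fun m => mul_one (M := 𝒜.Abar) m) fun v m => rfl)
  map_mul' a b := by
    rw [← MulOpposite.op_mul]
    refine congrArg MulOpposite.op ?_
    refine Eq.trans ?_ (ofLinear_comp (M := 𝒜.regular) (N := 𝒜.regular) (L := 𝒜.regular)
      (LinearMap.toSpanSingleton 𝒜.Abar 𝒜.Abar a) (LinearMap.toSpanSingleton 𝒜.Abar 𝒜.Abar b))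
    exact Hom.ext' (fun m => (mul_assoc (G := 𝒜.Abar) m a b).symm) fun v m => rfl
  map_zero' := congrArg MulOpposite.op (Hom.ext' (fun m => mul_zero (M₀ := 𝒜.Abar) m) fun v m => rfl)
  map_add' a b := by
    rw [← MulOpposite.op_add]
    refine congrArg MulOpposite.op ?_
    exact Hom.ext' (fun m => mul_add (R := 𝒜.Abar) m a b) fun v m => (add_zero _).symm

/-- The functor `F = Hom_𝒜(A̲, -)` from `𝒜-mod` to `Γ`-modules. -/
noncomputable abbrev F : 𝒜.FGMod ⥤ ModuleCat.{u} 𝒜.Γ := preadditiveCoyonedaObj 𝒜.regular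

/-- The functor `Γ ⊗_{A̲} -` from `A̲`-modules to `Γ`-modules. -/
noncomputable abbrev tensorΓ : ModuleCat.{u} 𝒜.Abar ⥤ ModuleCat.{u} 𝒜.Γ := extendScalarsFunctor 𝒜.toΓ

variable {𝒜}

/-- The elements of `R`, regarded as elements of `A`. -/
def ofR (r : 𝒜.R) : 𝒜.A := ⟨r, 𝒜.R_le r.2⟩

/-- `0 → M → E → N → 0` is a split exact sequence of `R`-modules. -/
def IsRSplitExact {M E N : 𝒜.FGMod} (f : M →ₗ[k] E) (g : E →ₗ[k] N) : Prop :=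
  (∀ (r : 𝒜.R) (m : M), f (ofR r • m) = ofR r • f m) ∧
  (∀ (r : 𝒜.R) (e : E), g (ofR r • e) = ofR r • g e) ∧
  Function.Injective f ∧ Function.Exact f g ∧
  ∃ s : N →ₗ[k] E, (∀ (r : 𝒜.R) (n : N), s (ofR r • n) = ofR r • s n) ∧ ∀ n, g (s n) = n

/-- The conflations of the exact structure on `𝒜-mod`: the pairs of composable morphisms which are
isomorphic to a pair `((φ⁰, 0), (ψ⁰, 0))` such that `0 → M' → E' → N' → 0` (with maps `φ⁰`, `ψ⁰`) is
a split exact sequence of `R`-modules. -/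
def IsConflation {M E N : 𝒜.FGMod} (f : M ⟶ E) (g : E ⟶ N) : Prop :=
  ∃ (M' E' N' : 𝒜.FGMod) (φ : Hom M' E') (ψ : Hom E' N') (a : M ≅ M') (b : E ≅ E') (c : N ≅ N'),
    φ.f1 = 0 ∧ ψ.f1 = 0 ∧ IsRSplitExact φ.f0 ψ.f0 ∧
    f ≫ b.hom = a.hom ≫ φ ∧ g ≫ c.hom = b.hom ≫ ψ

variable (𝒜)

/-- The full subcategory `ℐ` of the `Γ`-modules isomorphic to `Γ ⊗_{A̲} N` for some `N` in
`A̲-mod`. -/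
def induced : ObjectProperty (ModuleCat.{u} 𝒜.Γ) := fun X =>
  ∃ N : FGModuleCat.{u} 𝒜.Abar, Nonempty (X ≅ 𝒜.tensorΓ.obj N.obj)

end InterlacedWeakDitalgebra

open CategoryTheory

/-! A morphism `h : A̲ → N` of `𝒜`-mod is the same as a free choice of the element `h⁰(1) ∈ N` and
of the bimodule map `h¹`: the compatibility condition forces `h⁰(a) = a h⁰(1) - h¹(δ a)(1)`, and
this is well defined on `A̲` because `δ(I) ⊆ IV + VI` is killed by `h¹` (`exists_hom_regular`,
`Hom.regular_ext`). Since `T` is free over its layer, `h¹` amounts to an `R`-`R`-bimodule map `W₁ →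
Hom_k(A̲, N)`. As `R` is a finite product of copies of `k`, averaging over its idempotents is a
projection from all linear maps `W₁ → Hom_k(A̲, N)` onto the bimodule maps.

This projection is used twice. Expanding in `k`-bases of `W₁` and `A̲` and averaging gives a finite
dual basis of `Γ` as a right `A̲`-module (`exists_regularBasis`). Hence `Γ ⊗ -` is exact and `Γ ⊗ N
≅ Hom_𝒜(A̲, N)`, from which fullness and exactness of `F` follow. Moreover, `Hom_{A-A}(V, Hom_k(A̲,
N))` is a direct summand of the coinduced module `Hom_k(A̲, Hom_k(W₁, N))`, so it is an injective
`A̲`-module (`RegularBimodHom.injective`).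

The map `h ↦ h¹` therefore makes the unit `N → Γ ⊗ N` of extension and restriction of scalars a
monomorphism with injective cokernel (`exists_shortExact_unit`). The rest is formal. Let `F ⊣ G`
with `F` exact and `G` preserving epimorphisms, so that `F` preserves projectives. For `K` inside a
projective `Q`, every map `FK → FN` is `F` of a map `K → N` plus a map that extends to `FQ`. Applied
to a projective presentation `0 → K → Q → M → 0`, this says that extensions of `FM` by `FN` come
from extensions of `M` by `N`; dimension shifting gives the statements on higher `Ext`. -/

/-! ### Exact left adjoints whose unit has injective cokernel: extensions and `Ext`. -/

section UnitInjectiveCokernel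

open Limits Abelian

universe w w' v v' u' u''

variable {C : Type u'} [Category.{v} C] [Abelian C] {D : Type u''} [Category.{v'} D] [Abelian D]
  {F : C ⥤ D} {G : D ⥤ C} (adj : F ⊣ G) {N : C} {J : C}
  {p : G.obj (F.obj N) ⟶ J} {w : adj.unit.app N ≫ p = 0}

omit [Abelian C] in
/-- Maps from a subobject of a projective object to an injective quotient of `GFN` extend and lift. -/
theorem exists_extend_lift {X : C} (p : X ⟶ J) [Epi p] [Injective J] {K Q : C} (i : K ⟶ Q)
    [Mono i] [Projective Q] (t : K ⟶ J) : ∃ s : Q ⟶ X, i ≫ s ≫ p = t :=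
  ⟨Projective.factorThru (Injective.factorThru t i) p, by simp⟩

variable [F.Additive] [G.Additive]

omit [F.Additive] in
include adj in
/-- If the unit `N ⟶ GFN` is a monomorphism with injective cokernel, then every map `FK ⟶ FN` with
`K` a subobject of a projective `Q` is the sum of a map coming from `K ⟶ N` and a map which extends
to `FQ`. -/
theorem exists_map_add_map_comp [Injective J] (hS : (ShortComplex.mk _ p w).ShortExact)
    {K Q : C} (i : K ⟶ Q) [Mono i] [Projective Q] (g : F.obj K ⟶ F.obj N) :
    ∃ (f : K ⟶ N) (h : F.obj Q ⟶ F.obj N), g = F.map f + F.map i ≫ h := by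
  have := hS.epi_g
  have := hS.mono_f
  dsimp at *
  -- Let `s : Q ⟶ GFN` agree on `K` with the transpose of `g` modulo `N`. The difference dies in
  -- `J`, so it factors through the unit and gives `f`; the transpose of `s` is `h`.
  obtain ⟨s, hs⟩ := exists_extend_lift p i (adj.homEquiv _ _ g ≫ p)
  have hz : (adj.homEquiv _ _ g - i ≫ s) ≫ p = 0 := by
    rw [Preadditive.sub_comp, Category.assoc, hs, sub_self]
  obtain ⟨f, hf⟩ : ∃ f : K ⟶ N, f ≫ adj.unit.app N = adj.homEquiv _ _ g - i ≫ s :=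
    ⟨_, hS.exact.lift_f _ hz⟩
  refine ⟨f, (adj.homEquiv _ _).symm s, ?_⟩
  apply (adj.homEquiv _ _).injective
  have e1 : ∀ a b : F.obj K ⟶ F.obj N, adj.homEquiv _ _ (a + b) =
      adj.homEquiv _ _ a + adj.homEquiv _ _ b := fun a b => by
    simp [Adjunction.homEquiv_unit]
  rw [e1, adj.homEquiv_naturality_left, Equiv.apply_symm_apply, ← sub_eq_iff_eq_add, ← hf,
    Adjunction.homEquiv_unit]
  exact adj.unit.naturality _

/-- A kernel sequence `0 ⟶ K ⟶ Q ⟶ M ⟶ 0` with `Q` projective. -/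
theorem exists_shortExact_projective [EnoughProjectives C] (M : C) :
    ∃ (K Q : C) (i : K ⟶ Q) (q : Q ⟶ M) (hw : i ≫ q = 0), Projective Q ∧
      (ShortComplex.mk i q hw).ShortExact := by
  let P : ProjectivePresentation M := Classical.arbitrary _
  exact ⟨_, P.p, kernel.ι P.f, P.f, kernel.condition P.f, P.projective,
    { exact := ShortComplex.exact_kernel P.f }⟩

variable [PreservesFiniteLimits F] [PreservesFiniteColimits F] [EnoughProjectives C]
  [G.PreservesEpimorphisms]

include adj in
/-- If the unit at `N` is a monomorphism with injective cokernel, then every extension of `FM` by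
`FN` comes from an extension of `M` by `N`. -/
theorem exists_shortExact_iso_map [Injective J] (hS : (ShortComplex.mk _ p w).ShortExact)
    {M : C} {T : ShortComplex D} (hT : T.ShortExact) (e₁ : T.X₁ ≅ F.obj N) (e₃ : T.X₃ ≅ F.obj M) :
    ∃ (E : C) (f : N ⟶ E) (g : E ⟶ M) (hw : f ≫ g = 0), (ShortComplex.mk f g hw).ShortExact ∧
      Nonempty (T.X₂ ≅ F.obj E) := by
  obtain ⟨K, Q, i, q, hw, hQ, hK⟩ := exists_shortExact_projective M
  have hFQ : Projective (F.obj Q) := adj.map_projective _ hQ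
  have hi : Mono i := hK.mono_f
  have hq : Epi q := hK.epi_g
  have := hT.epi_g
  have := hT.mono_f
  have hFw : F.map i ≫ F.map q = 0 := by rw [← F.map_comp, hw, F.map_zero]
  -- Lifting `FQ ⟶ FM` to the middle term and restricting to `FK` yields a map `FK ⟶ FN` that
  -- classifies the extension `T`.
  let l : F.obj Q ⟶ T.X₂ := Projective.factorThru (F.map q ≫ e₃.inv) T.g
  have hl : l ≫ T.g = F.map q ≫ e₃.inv := Projective.factorThru_comp _ _
  have hz : (F.map i ≫ l) ≫ T.g = 0 := by
    rw [Category.assoc, hl, reassoc_of% hFw, zero_comp]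
  have hm := hT.exact.lift_f _ hz
  obtain ⟨f, h, hfh⟩ := exists_map_add_map_comp adj hS i (hT.exact.lift _ hz ≫ e₁.hom)
  -- Another choice of lift changes the classifying map by a map that extends to `FQ`. With this
  -- choice it becomes `F.map f`, so `T` should be the image of the pushout of `0 → K → Q → M → 0`
  -- along `f`.
  let l' := l - h ≫ e₁.inv ≫ T.f
  have hl' : F.map i ≫ l' = F.map f ≫ e₁.inv ≫ T.f := by
    have : F.map f = hT.exact.lift _ hz ≫ e₁.hom - F.map i ≫ h := by rw [hfh]; abel
    simp only [l', this, Preadditive.comp_sub, Preadditive.sub_comp, Category.assoc,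
      Iso.hom_inv_id_assoc, hm]
  have hl'' : l' ≫ T.g = F.map q ≫ e₃.inv := by
    simp only [l', Preadditive.sub_comp, Category.assoc, T.zero, comp_zero, sub_zero, hl]
  have sq := IsPushout.of_hasPushout f i
  let g' : pushout f i ⟶ M := pushout.desc 0 q (by rw [comp_zero, hw])
  have hg1 : pushout.inl f i ≫ g' = 0 := pushout.inl_desc _ _ _
  have hg2 : pushout.inr f i ≫ g' = q := pushout.inr_desc _ _ _
  have hepi : Epi g' := by
    have : Epi (pushout.inr f i ≫ g') := by rw [hg2]; infer_instance
    exact epi_of_epi (pushout.inr f i) g'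
  have hex : (ShortComplex.mk (pushout.inl f i) g' hg1).ShortExact := by
    have hmono : Mono (pushout.inl f i) := inferInstance
    refine { exact := ShortComplex.exact_of_g_is_cokernel _ ?_, mono_f := hmono, epi_g := hepi }
    refine CokernelCofork.IsColimit.ofπ' _ _ fun {Z} t ht => ?_
    dsimp at t ht
    have hz : i ≫ pushout.inr f i ≫ t = 0 := by
      rw [← pushout.condition_assoc, ht, comp_zero]
    refine ⟨hK.exact.desc (pushout.inr f i ≫ t) hz, ?_⟩
    dsimp
    apply pushout.hom_ext
    · rw [reassoc_of% hg1, zero_comp, ht]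
    · rw [reassoc_of% hg2]
      exact hK.exact.g_desc _ hz
  refine ⟨pushout f i, pushout.inl f i, g', hg1, hex, ?_⟩
  have hFE := hex.map_of_exact F
  -- `F` preserves the pushout, so the corrected lift induces a map from `F` of the pushout to
  -- `T.X₂`; the five lemma makes it an isomorphism.
  let sqF := sq.map F
  let t := sqF.desc (e₁.inv ≫ T.f) l' hl'.symm
  have ht1 : F.map (pushout.inl f i) ≫ t = e₁.inv ≫ T.f := sqF.inl_desc _ _ _
  have ht2 : F.map (pushout.inr f i) ≫ t = l' := sqF.inr_desc _ _ _
  have ht3 : t ≫ T.g = F.map g' ≫ e₃.inv := by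
    apply sqF.hom_ext
    · rw [reassoc_of% ht1, T.zero, comp_zero, ← F.map_comp_assoc, hg1, F.map_zero, zero_comp]
    · rw [reassoc_of% ht2, hl'', ← F.map_comp_assoc, hg2]
  let φ : (ShortComplex.mk (pushout.inl f i) g' hg1).map F ⟶ T :=
    { τ₁ := e₁.inv
      τ₂ := t
      τ₃ := e₃.inv
      comm₁₂ := ht1.symm
      comm₂₃ := ht3 }
  have h1 : IsIso φ.τ₁ := inferInstanceAs (IsIso e₁.inv)
  have h3 : IsIso φ.τ₃ := inferInstanceAs (IsIso e₃.inv)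
  have h2 : IsIso φ.τ₂ := ShortComplex.isIso₂_of_shortExact_of_isIso₁₃ φ hFE hT
  exact ⟨(asIso φ.τ₂).symm⟩

variable [HasExt.{w} C] [HasExt.{w'} D]

-- The compatibility that allows dimension shifting on both sides at once: multiplication by the
-- class of `K ⟶ Q ⟶ M` corresponds under `F` to multiplication by the class of the image sequence.
omit [EnoughProjectives C] in
theorem mapExactFunctor_extClass_comp {K Q M : C} {i : K ⟶ Q} {q : Q ⟶ M} {hw : i ≫ q = 0}
    (hK : (ShortComplex.mk i q hw).ShortExact) {hw' : F.map i ≫ F.map q = 0}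
    (hFK : (ShortComplex.mk (F.map i) (F.map q) hw').ShortExact) {n m : ℕ} (h : 1 + n = m)
    (y : Ext.{w} K N n) : (Ext.comp (b := n) (hK.extClass : Ext M K 1) y h).mapExactFunctor F =
      Ext.comp (hFK.extClass : Ext.{w'} (F.obj M) (F.obj K) 1) (y.mapExactFunctor F) h := by
  rw [Ext.mapExactFunctor_comp, Ext.mapExactFunctor_extClass]
  rfl

omit [HasExt.{w} C] [HasExt.{w'} D] in
/-- A kernel sequence `0 ⟶ K ⟶ Q ⟶ M ⟶ 0` with `Q` projective, together with its image. -/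
theorem exists_shortExact_map_projective (M : C) :
    ∃ (K Q : C) (i : K ⟶ Q) (q : Q ⟶ M) (hw : i ≫ q = 0) (hw' : F.map i ≫ F.map q = 0),
      Projective Q ∧ (ShortComplex.mk i q hw).ShortExact ∧
      (ShortComplex.mk (F.map i) (F.map q) hw').ShortExact := by
  obtain ⟨K, Q, i, q, hw, hQ, hK⟩ := exists_shortExact_projective M
  exact ⟨K, Q, i, q, hw, by rw [← F.map_comp, hw, F.map_zero], hQ, hK, hK.map_of_exact F⟩

-- Since `FQ` is projective, every class of positive degree on `FM` is the class of the image
-- sequence times a class on `FK` of one degree less. This reduces to degree one, where a map `FK ⟶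
-- FN` is left and `exists_map_add_map_comp` splits it.
include adj in
theorem mapExtAddHom_surjective_of_injective_cokernel [Injective J]
    (hS : (ShortComplex.mk _ p w).ShortExact) (M : C) (n : ℕ) :
    Function.Surjective (F.mapExtAddHom M N (n + 1)) := by
  induction n generalizing M with
  | zero =>
    intro x
    obtain ⟨K, Q, i, q, hw, hw', hQ, hK, hFK⟩ := exists_shortExact_map_projective (F := F) M
    have hFQ : Projective (F.obj Q) := adj.map_projective _ hQ
    have hi : Mono i := hK.mono_f
    obtain ⟨y, rfl⟩ := Ext.contravariant_sequence_exact₃ hFK _ x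
      (@Ext.eq_zero_of_projective _ _ _ _ _ _ _ hFQ _) (add_comm 1 0)
    obtain ⟨g, rfl⟩ := (Ext.mk₀_bijective _ _).surjective y
    obtain ⟨f, h, rfl⟩ := exists_map_add_map_comp adj hS i g
    refine ⟨hK.extClass.comp (Ext.mk₀ f) (add_comm 1 0), ?_⟩
    rw [Functor.mapExtAddHom_apply, mapExactFunctor_extClass_comp hK hFK,
      Ext.mapExactFunctor_mk₀, Ext.mk₀_add, Ext.comp_add,
      ← Ext.mk₀_comp_mk₀]
    -- The summand that extends to `FQ` is annihilated by the extension class, so only `F.map f`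
    -- contributes.
    have := hFK.extClass_comp_assoc (Ext.mk₀ h) (h := add_comm 1 0)
    dsimp at this
    rw [this, add_zero]
  | succ n ih =>
    intro x
    obtain ⟨K, Q, i, q, hw, hw', hQ, hK, hFK⟩ := exists_shortExact_map_projective (F := F) M
    have hFQ : Projective (F.obj Q) := adj.map_projective _ hQ
    obtain ⟨y, rfl⟩ := Ext.contravariant_sequence_exact₃ hFK _ x
      (@Ext.eq_zero_of_projective _ _ _ _ _ _ _ hFQ _) (add_comm 1 (n + 1))
    obtain ⟨z, rfl⟩ := ih K y
    refine ⟨hK.extClass.comp z (add_comm 1 (n + 1)), ?_⟩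
    rw [Functor.mapExtAddHom_apply, mapExactFunctor_extClass_comp hK hFK]
    rfl

omit [G.Additive] [G.PreservesEpimorphisms] in
include adj in
/-- Injectivity on `Ext¹(K, N)` for subobjects `K` of projective objects. -/
theorem eq_zero_of_mapExactFunctor_eq_zero [Injective J]
    (hS : (ShortComplex.mk _ p w).ShortExact) {K Q : C} (i : K ⟶ Q) [Mono i] [Projective Q]
    (y : Ext.{w} K N 1) (hy : y.mapExactFunctor F = (0 : Ext.{w'} _ _ 1)) : y = 0 := by
  obtain ⟨K', Q', i', q', hw, hw', hQ', hK, hFK⟩ := exists_shortExact_map_projective (F := F) K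
  have := hS.epi_g
  have := hS.mono_f
  have := hK.epi_g
  dsimp at *
  obtain ⟨y, rfl⟩ := Ext.contravariant_sequence_exact₃ hK _ y
      (@Ext.eq_zero_of_projective _ _ _ _ _ _ _ hQ' _) (add_comm 1 0)
  obtain ⟨f, rfl⟩ := (Ext.mk₀_bijective _ _).surjective y
  rw [mapExactFunctor_extClass_comp hK hFK,
    Ext.mapExactFunctor_mk₀] at hy
  -- The class `y` is represented by `f : K' ⟶ N`. That its image vanishes means that `F.map f`
  -- extends along `F.map i'` to `h : FQ' ⟶ FN`; the goal is to extend `f` itself to `Q'`.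
  obtain ⟨h, hh⟩ := Ext.contravariant_sequence_exact₁ hFK _ _ (add_comm 1 0) hy
  obtain ⟨h, rfl⟩ := (Ext.mk₀_bijective _ _).surjective h
  rw [Ext.mk₀_comp_mk₀] at hh
  replace hh := (Ext.mk₀_bijective _ _).injective hh
  dsimp at hh
  have hh' : i' ≫ adj.homEquiv _ _ h = f ≫ adj.unit.app N := by
    rw [← adj.homEquiv_naturality_left, hh, Adjunction.homEquiv_unit]
    exact (adj.unit.naturality _).symm
  have hz : i' ≫ adj.homEquiv _ _ h ≫ p = 0 := by
    rw [reassoc_of% hh', w, comp_zero]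
  -- The transpose of `h`, followed by `p`, vanishes on `K'` and so descends to `K ⟶ J`. That map
  -- extends to `Q` and lifts to `GFN`; this is where `K` has to lie inside a projective.
  obtain ⟨s, hs⟩ := exists_extend_lift p i (hK.exact.desc _ hz)
  have hz' : (adj.homEquiv _ _ h - q' ≫ i ≫ s) ≫ p = 0 := by
    rw [Preadditive.sub_comp, Category.assoc, Category.assoc, hs]
    have := hK.exact.g_desc _ hz
    dsimp at this
    rw [this, sub_self]
  -- Subtracting `q' ≫ i ≫ s` makes the transpose land in `N` and does not alter it on `K'`, so the
  -- resulting `t` extends `f`.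
  have ht := hS.exact.lift_f _ hz'
  set t := hS.exact.lift _ hz'
  dsimp at t ht
  have hit : i' ≫ t = f := by
    rw [← cancel_mono (adj.unit.app N), Category.assoc, ht, Preadditive.comp_sub, hh',
      reassoc_of% hw, zero_comp, sub_zero]
  rw [← hit, ← Ext.mk₀_comp_mk₀]
  exact hK.extClass_comp_assoc (Ext.mk₀ t) (h := add_comm 1 0)

-- One dimension shift replaces `M` by a subobject `K` of a projective, where injectivity on `Ext¹`
-- is available. This initial shift is why the range starts in degree two.
omit [G.Additive] in
include adj in
theorem mapExtAddHom_injective_of_injective_cokernel [Injective J]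
    (hS : (ShortComplex.mk _ p w).ShortExact) (M : C) (n : ℕ) :
    Function.Injective (F.mapExtAddHom M N (n + 2)) := by
  rw [injective_iff_map_eq_zero]
  induction n generalizing M with
  | zero =>
    intro x hx
    obtain ⟨K, Q, i, q, hw, hw', hQ, hK, hFK⟩ := exists_shortExact_map_projective (F := F) M
    have hFQ : Projective (F.obj Q) := adj.map_projective _ hQ
    have hi : Mono i := hK.mono_f
    obtain ⟨y, rfl⟩ := Ext.contravariant_sequence_exact₃ hK _ x
      (@Ext.eq_zero_of_projective _ _ _ _ _ _ _ hQ _) (add_comm 1 1)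
    rw [Functor.mapExtAddHom_apply, mapExactFunctor_extClass_comp hK hFK] at hx
    -- The kernel of multiplication by the class of the image sequence comes from `Ext¹(FQ, FN)`,
    -- which is zero, so the image of `y` already vanishes.
    obtain ⟨z, hz⟩ := Ext.contravariant_sequence_exact₁ hFK _ _ (add_comm 1 _) hx
    rw [@Ext.eq_zero_of_projective _ _ _ _ _ _ _ hFQ z, Ext.comp_zero] at hz
    rw [eq_zero_of_mapExactFunctor_eq_zero adj hS i y hz.symm, Ext.comp_zero]
  | succ n ih =>
    intro x hx
    obtain ⟨K, Q, i, q, hw, hw', hQ, hK, hFK⟩ := exists_shortExact_map_projective (F := F) M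
    have hFQ : Projective (F.obj Q) := adj.map_projective _ hQ
    obtain ⟨y, rfl⟩ := Ext.contravariant_sequence_exact₃ hK _ x
      (@Ext.eq_zero_of_projective _ _ _ _ _ _ _ hQ _) (add_comm 1 (n + 2))
    rw [Functor.mapExtAddHom_apply, mapExactFunctor_extClass_comp hK hFK] at hx
    obtain ⟨z, hz⟩ := Ext.contravariant_sequence_exact₁ hFK _ _ (add_comm 1 _) hx
    rw [@Ext.eq_zero_of_projective _ _ _ _ _ _ _ hFQ z, Ext.comp_zero] at hz
    rw [ih K y hz.symm, Ext.comp_zero]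

end UnitInjectiveCokernel

/-! ### Extension of scalars along a ring homomorphism: adjunction, finiteness and exactness. -/

section InducedModules

open TensorProduct

variable {A B : Type u} [Ring A] [Ring B] (φ : A →+* B)

/-- The element `b ⊗ m` of `B ⊗_A M`. -/
def inducedTmul {M : ModuleCat.{u} A} (b : B) (m : M) : (extendScalarsFunctor φ).obj M :=
  Submodule.Quotient.mk (p := inducedRel φ M) (b ⊗ₜ[ℤ] m)

variable {M N : ModuleCat.{u} A}

theorem inducedTmul_add (b : B) (m m' : M) :
    inducedTmul φ b (m + m') = inducedTmul φ b m + inducedTmul φ b m' := by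
  unfold inducedTmul
  rw [TensorProduct.tmul_add]
  rfl

theorem inducedTmul_zero (b : B) : inducedTmul φ b (0 : M) = 0 := by
  unfold inducedTmul
  rw [TensorProduct.tmul_zero]
  rfl

theorem add_inducedTmul (b b' : B) (m : M) :
    inducedTmul φ (b + b') m = inducedTmul φ b m + inducedTmul φ b' m := by
  unfold inducedTmul
  rw [TensorProduct.add_tmul]
  rfl

theorem inducedTmul_sum {ι : Type*} (s : Finset ι) (b : ι → B) (m : M) :
    inducedTmul φ (∑ i ∈ s, b i) m = ∑ i ∈ s, inducedTmul φ (b i) m :=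
  map_sum (AddMonoidHom.mk' (fun b => inducedTmul φ b m) fun b b' => add_inducedTmul φ b b' m) b s

theorem smul_inducedTmul (b b' : B) (m : M) :
    b • inducedTmul φ b' m = inducedTmul φ (b * b') m := rfl

theorem inducedTmul_smul (b : B) (a : A) (m : M) :
    inducedTmul φ b (a • m) = inducedTmul φ (b * φ a) m :=
  ((Submodule.Quotient.eq (inducedRel φ M) (x := (b * φ a) ⊗ₜ[ℤ] m) (y := b ⊗ₜ[ℤ] (a • m))).2
    (Submodule.subset_span ⟨b, a, m, rfl⟩)).symm

theorem extendScalarsFunctor_map_tmul (f : M ⟶ N) (b : B) (m : M) :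
    (extendScalarsFunctor φ).map f (inducedTmul φ b m) = inducedTmul φ b (f m) := rfl

@[elab_as_elim]
theorem inducedTmul_induction {P : (extendScalarsFunctor φ).obj M → Prop}
    (x : (extendScalarsFunctor φ).obj M) (h0 : P 0) (h : ∀ b m, P (inducedTmul φ b m))
    (ha : ∀ x y, P x → P y → P (x + y)) : P x := by
  obtain ⟨x, rfl⟩ := Submodule.Quotient.mk_surjective _ x
  induction x with
  | zero => exact h0
  | tmul b m => exact h b m
  | add x y hx hy => exact ha _ _ hx hy

theorem extendScalarsFunctor_hom_ext {X : ModuleCat.{u} B}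
    {f g : (extendScalarsFunctor φ).obj M ⟶ X}
    (h : ∀ m, f (inducedTmul φ 1 m) = g (inducedTmul φ 1 m)) : f = g := by
  refine ModuleCat.hom_ext (LinearMap.ext fun x => ?_)
  induction x using inducedTmul_induction φ with
  | h0 => rw [map_zero, map_zero]
  | h b m =>
    have : inducedTmul φ b m = b • inducedTmul φ 1 m := by rw [smul_inducedTmul, mul_one]
    rw [this, map_smul, map_smul]
    exact congrArg (b • ·) (h m)
  | ha x y hx hy => rw [map_add, map_add, hx, hy]

/-- The map `B ⊗_A M ⟶ X`, `b ⊗ m ↦ b f(m)`. -/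
noncomputable def extendScalarsLift {X : ModuleCat.{u} B} (f : M ⟶ (ModuleCat.restrictScalars φ).obj X) :
    (extendScalarsFunctor φ).obj M ⟶ X :=
  ModuleCat.ofHom ((inducedRel φ M).liftQ
    (TensorProduct.AlgebraTensorModule.lift
      (LinearMap.toSpanSingleton B (M →ₗ[ℤ] X) (f.hom.toAddMonoidHom.toIntLinearMap))) (by
    refine Submodule.span_le.2 ?_
    rintro x ⟨b, a, m, rfl⟩
    have h : f (a • m) = φ a • (f m : X) := map_smul f.hom a m
    rw [SetLike.mem_coe, LinearMap.mem_ker, map_sub]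
    change (b * φ a) • (f m : X) - b • (f (a • m) : X) = 0
    rw [h, mul_smul, sub_self]))

/-- Extension of scalars is left adjoint to restriction of scalars. -/
noncomputable def extendScalarsFunctorAdj :
    extendScalarsFunctor φ ⊣ ModuleCat.restrictScalars.{u} φ :=
  Adjunction.mkOfHomEquiv
    { homEquiv := fun M X =>
        { toFun := fun g => ModuleCat.ofHom (Y := (ModuleCat.restrictScalars φ).obj X)
            { toFun := fun m => g (inducedTmul φ 1 m)
              map_add' := fun m m' => by rw [inducedTmul_add, map_add]; rfl
              map_smul' := fun a m => by
                rw [inducedTmul_smul, one_mul]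
                have : inducedTmul φ (φ a) m = φ a • inducedTmul φ 1 m := by
                  rw [smul_inducedTmul, mul_one]
                rw [this, map_smul]
                rfl }
          invFun := extendScalarsLift φ
          left_inv := fun g => extendScalarsFunctor_hom_ext φ fun m => one_smul B _
          right_inv := fun f => ModuleCat.hom_ext (LinearMap.ext fun m => one_smul B (f m : X)) }
      homEquiv_naturality_left_symm := fun f g => extendScalarsFunctor_hom_ext φ fun m => rfl
      homEquiv_naturality_right := fun f g => rfl }

theorem extendScalarsFunctor_finite [Module.Finite A M] :
    Module.Finite B ((extendScalarsFunctor φ).obj M) := by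
  classical
  obtain ⟨s, hs⟩ := Module.Finite.fg_top (R := A) (M := M)
  refine ⟨⟨s.image (inducedTmul φ 1), ?_⟩⟩
  refine Submodule.eq_top_iff'.2 fun x => ?_
  induction x using inducedTmul_induction φ with
  | h0 => exact zero_mem _
  | h b m =>
    suffices h : ∀ m ∈ Submodule.span A (s : Set M), inducedTmul φ 1 m ∈
        Submodule.span B ((s.image (inducedTmul φ 1) : Finset _) : Set _) by
      have : inducedTmul φ b m = b • inducedTmul φ 1 m := by rw [smul_inducedTmul, mul_one]
      rw [this]
      exact Submodule.smul_mem _ _ (h m (hs ▸ Submodule.mem_top))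
    intro m hm
    induction hm using Submodule.span_induction with
    | mem m hm => exact Submodule.subset_span (Finset.mem_coe.2 (Finset.mem_image_of_mem _ hm))
    | zero => rw [inducedTmul_zero]; exact zero_mem _
    | add m m' _ _ hm hm' => rw [inducedTmul_add]; exact add_mem hm hm'
    | smul a m _ hm =>
      have : inducedTmul φ 1 (a • m) = φ a • inducedTmul φ 1 m := by
        rw [inducedTmul_smul, smul_inducedTmul, one_mul, mul_one]
      rw [this]
      exact Submodule.smul_mem _ _ hm
  | ha x y hx hy => exact add_mem hx hy

variable (M) in
/-- A right `A`-linear map `c : B → A` induces an additive map `B ⊗_A M → M`. -/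
theorem exists_inducedCoord (c : B →+ A) (hc : ∀ b a, c (b * φ a) = c b * a) :
    ∃ d : (extendScalarsFunctor φ).obj M →+ M, ∀ b m, d (inducedTmul φ b m) = c b • m := by
  let e : B ⊗[ℤ] M →ₗ[ℤ] M := TensorProduct.lift (LinearMap.mk₂ ℤ (fun b m => c b • m)
    (fun b b' m => by rw [map_add, add_smul]) (fun n b m => by rw [map_zsmul, smul_assoc])
    (fun b m m' => smul_add _ _ _) (fun n b m => smul_comm _ _ _))
  -- The relations form a `B`-span while `e` is only additive, so the claim is made for all
  -- multiples `b • x` in order to pass through the induction on the span.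
  have he : ∀ x ∈ inducedRel φ M, ∀ b : B, e (b • x) = 0 := by
    intro x hx
    induction hx using Submodule.span_induction with
    | mem x hx =>
      obtain ⟨b, a, m, rfl⟩ := hx
      intro b'
      rw [smul_sub, map_sub]
      change c (b' * (b * φ a)) • m - c (b' * b) • a • m = 0
      rw [← mul_assoc, hc, mul_smul, sub_self]
    | zero => intro b; rw [smul_zero, map_zero]
    | add x y _ _ hx hy => intro b; rw [smul_add, map_add, hx, hy, add_zero]
    | smul b x _ hx => intro b'; rw [← mul_smul, hx]
  exact ⟨QuotientAddGroup.lift (inducedRel φ M).toAddSubgroup e.toAddMonoidHom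
    fun x hx => by simpa using he x hx 1, fun b m => rfl⟩

/-- If `B` has a finite dual basis as a right `A`-module, then `B ⊗_A -` is exact. -/
theorem extendScalarsFunctor_exact {ι : Type*} [Fintype ι] (γ : ι → B) (c : ι → B →+ A)
    (hc : ∀ i b a, c i (b * φ a) = c i b * a) (hγ : ∀ b, ∑ i, γ i * φ (c i b) = b) :
    Limits.PreservesFiniteLimits (extendScalarsFunctor φ) ∧
      Limits.PreservesFiniteColimits (extendScalarsFunctor φ) := by
  refine ((extendScalarsFunctor φ).exact_tfae.out 1 3).1 fun S hS => ?_
  -- The coordinates `d` are natural in the module and recover `x` as `∑ γ i ⊗ d i x`. Thus `B ⊗_A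
  -- -` is, on additive groups, a natural retract of a finite power of the identity functor, and
  -- exactness can be checked coordinate by coordinate.
  choose d hd using fun (M : ModuleCat.{u} A) i => exists_inducedCoord φ M (c i) (hc i)
  have hsum : ∀ {M : ModuleCat.{u} A} (x : (extendScalarsFunctor φ).obj M),
      ∑ i, inducedTmul φ (γ i) (d M i x) = x := by
    intro M x
    induction x using inducedTmul_induction φ with
    | h0 => simp only [map_zero, inducedTmul_zero, Finset.sum_const_zero]
    | h b m =>
      simp only [hd, inducedTmul_smul]
      rw [← inducedTmul_sum, hγ]
    | ha x y hx hy =>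
      simp only [map_add, inducedTmul_add, Finset.sum_add_distrib, hx, hy]
  have hnat : ∀ {M N : ModuleCat.{u} A} (f : M ⟶ N) i (x : (extendScalarsFunctor φ).obj M),
      d N i ((extendScalarsFunctor φ).map f x) = f (d M i x) := by
    intro M N f i x
    induction x using inducedTmul_induction φ with
    | h0 => simp only [map_zero]
    | h b m => rw [extendScalarsFunctor_map_tmul, hd, hd, map_smul]
    | ha x y hx hy => simp only [map_add, hx, hy]
  rw [ShortComplex.moduleCat_exact_iff] at hS ⊢
  intro x hx
  have h1 : ∀ i, S.g (d _ i x) = 0 := fun i =>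
    (hnat S.g i x).symm.trans ((congrArg (d _ i) hx).trans (map_zero _))
  choose y hy using fun i => hS _ (h1 i)
  refine ⟨∑ i, inducedTmul φ (γ i) (y i), ?_⟩
  refine (map_sum ((extendScalarsFunctor φ).map S.f).hom _ _).trans ?_
  refine Eq.trans ?_ (hsum x)
  exact Finset.sum_congr rfl fun i _ => congrArg (inducedTmul φ (γ i)) (hy i)

end InducedModules

/-! ### Bimodule maps out of `V`, and averaging over the idempotents of `R`. -/

namespace InterlacedWeakDitalgebra

open WeakDitalgebra

variable {k : Type u} [Field k] {𝒜 : InterlacedWeakDitalgebra k}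

/-- An element of `W₁`, regarded as an element of `V`. -/
def ofW₁ (w : 𝒜.W₁) : 𝒜.V := ⟨w, 𝒜.W₁_le w.2⟩

/-- The bimodule action of `R` on `W₁`. -/
def mulW₁ (r : 𝒜.R) (w : 𝒜.W₁) (s : 𝒜.R) : 𝒜.W₁ := ⟨r * w * s, 𝒜.W₁_mul r.2 w.2 s.2⟩

theorem ofW₁_mulW₁ (r : 𝒜.R) (w : 𝒜.W₁) (s : 𝒜.R) :
    ofW₁ (mulW₁ r w s) = 𝒜.rmul (𝒜.lmul (ofR r) (ofW₁ w)) (ofR s) := rfl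

theorem BimodHom.apply_mulW₁ {M N : 𝒜.FGMod} (f : 𝒜.BimodHom M N) (r : 𝒜.R) (w : 𝒜.W₁) (s : 𝒜.R)
    (m : M) : f.1 (ofW₁ (mulW₁ r w s)) m = ofR r • f.1 (ofW₁ w) (ofR s • m) := by
  rw [ofW₁_mulW₁, f.2.2, f.2.1]

/-- The bimodule `V` is generated by `W₁`. -/
theorem BimodHom.ext_W₁ {M N : 𝒜.FGMod} {f g : 𝒜.BimodHom M N}
    (h : ∀ w m, f.1 (ofW₁ w) m = g.1 (ofW₁ w) m) : f = g := by
  have hspan : 𝒜.V ≤ Submodule.map 𝒜.V.subtype (LinearMap.eqLocus f.1 g.1) := by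
    refine (𝒜.deg_eq_comp 1).le.trans ?_
    change 𝒜.comp 0 * 𝒜.W₁ * 𝒜.comp 0 ≤ _
    rw [Submodule.mul_le]
    intro x hx b hb
    refine Submodule.mul_induction_on hx (fun a ha w hw => ?_) (fun x y hx hy => ?_)
    · have ha' : a ∈ 𝒜.A := 𝒜.comp_le_deg 0 ha
      have hb' : b ∈ 𝒜.A := 𝒜.comp_le_deg 0 hb
      refine ⟨𝒜.rmul (𝒜.lmul ⟨a, ha'⟩ (ofW₁ ⟨w, hw⟩)) ⟨b, hb'⟩, ?_, rfl⟩
      refine LinearMap.ext fun m => ?_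
      rw [f.2.2, f.2.1, g.2.2, g.2.1, h]
    · rw [add_mul]
      exact add_mem hx hy
  refine Subtype.ext (LinearMap.ext fun v => ?_)
  obtain ⟨v, hv⟩ := v
  obtain ⟨w, hw, hwv⟩ := hspan hv
  have : w = ⟨v, hv⟩ := Subtype.ext hwv
  subst this
  exact hw

/-- `V` is the `A`-`A`-bimodule freely generated by the `R`-`R`-bimodule `W₁`. -/
theorem BimodHom.exists_of_W₁ {M N : 𝒜.FGMod} (ψ : 𝒜.W₁ →ₗ[k] (M →ₗ[k] N))
    (hψ : ∀ r w s m, ψ (mulW₁ r w s) m = ofR r • ψ w (ofR s • m)) :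
    ∃ f : 𝒜.BimodHom M N, ∀ w, f.1 (ofW₁ w) = ψ w := by
  have hR : 𝒜.R ≤ 𝒜.A := fun x hx => 𝒜.R_le hx
  let i0 : 𝒜.W₀ →ₗ[k] 𝒜.A :=
    { toFun := fun w => ⟨w, 𝒜.W₀_le w.2⟩, map_add' := fun _ _ => rfl, map_smul' := fun _ _ => rfl }
  let ρ : 𝒜.A →ₐ[k] Module.End k (M × N) := Algebra.lsmul k k (M × N)
  have hρ : ∀ a x, ρ a x = a • x := fun _ _ => rfl
  -- `A` acts diagonally on `M × N` and `W₁` by strictly triangular matrices with entry `ψ`. In the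
  -- resulting representation of the free algebra, the off-diagonal block of the image of `v ∈ V` is
  -- the required map.
  let Ψ : 𝒜.W₁ →ₗ[k] Module.End k (M × N) :=
    { toFun := fun w => LinearMap.prod 0 (ψ w ∘ₗ LinearMap.fst k M N)
      map_add' := fun v w => LinearMap.ext fun x => by simp
      map_smul' := fun c v => LinearMap.ext fun x => by simp }
  have hΨ : ∀ w x, Ψ w x = (0, ψ w x.1) := fun _ _ => rfl
  obtain ⟨Φ, ⟨h1, h2, h3⟩, -⟩ := 𝒜.free (Module.End k (M × N)) (ρ.comp (Subalgebra.inclusion hR))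
    (ρ.toLinearMap ∘ₗ i0) Ψ
    (fun r s w => by
      change ρ (Subalgebra.inclusion hR r * i0 w * Subalgebra.inclusion hR s) = _
      rw [map_mul, map_mul]
      rfl)
    (fun r s w => by
      refine LinearMap.ext fun x => ?_
      rw [Module.End.mul_apply, Module.End.mul_apply]
      change Ψ (mulW₁ r w s) x = ofR r • Ψ w (ofR s • x)
      rw [hΨ, hΨ, hψ, Prod.smul_mk, smul_zero]
      rfl)
  have hA : ∀ a : 𝒜.A, Φ a = ρ a := by
    rintro ⟨a, ha⟩
    have ha' : a ∈ Algebra.adjoin k ((𝒜.R : Set 𝒜.T) ∪ (𝒜.W₀ : Set 𝒜.T)) :=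
      (𝒜.deg_eq_comp 0).le ha
    induction ha' using Algebra.adjoin_induction with
    | mem x hx =>
      rcases hx with hx | hx
      · exact h1 ⟨x, hx⟩
      · exact h2 ⟨x, hx⟩
    | algebraMap r =>
      have : (⟨algebraMap k 𝒜.T r, ha⟩ : 𝒜.A) = algebraMap k 𝒜.A r := rfl
      rw [this, AlgHom.commutes]
      exact Φ.commutes r
    | add x y hx hy ihx ihy =>
      have : (⟨x + y, ha⟩ : 𝒜.A) = ⟨x, 𝒜.adjoin_le_A hx⟩ + ⟨y, 𝒜.adjoin_le_A hy⟩ := rfl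
      rw [this, map_add, ← ihx, ← ihy]
      exact map_add Φ x y
    | mul x y hx hy ihx ihy =>
      have : (⟨x * y, ha⟩ : 𝒜.A) = ⟨x, 𝒜.adjoin_le_A hx⟩ * ⟨y, 𝒜.adjoin_le_A hy⟩ := rfl
      rw [this, map_mul, ← ihx, ← ihy]
      exact map_mul Φ x y
  let f : 𝒜.V →ₗ[k] (M →ₗ[k] N) :=
    { toFun := fun v => LinearMap.snd k M N ∘ₗ Φ v ∘ₗ LinearMap.inl k M N
      map_add' := fun x y => LinearMap.ext fun m => by simp
      map_smul' := fun c x => LinearMap.ext fun m => by simp }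
  have hf : ∀ v m, f v m = (Φ v (m, 0)).2 := fun _ _ => rfl
  refine ⟨⟨f, fun a v m => ?_, fun a v m => ?_⟩, fun w => LinearMap.ext fun m => ?_⟩
  · rw [hf, hf]
    change (Φ (a * v) (m, 0)).2 = _
    rw [map_mul, Module.End.mul_apply, hA, hρ]
    rfl
  · rw [hf, hf]
    change (Φ (v * a) (m, 0)).2 = _
    rw [map_mul, Module.End.mul_apply, hA, hρ, Prod.smul_mk, smul_zero]
  · change (Φ (w : 𝒜.T) (m, 0)).2 = _
    rw [h3]
    rfl

variable (𝒜) in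
/-- The primitive idempotents of an algebra `R` isomorphic to a finite product of copies of `k`. -/
structure LayerIdempotents (ι : Type) [Fintype ι] where
  /-- The idempotents. -/
  e : ι → 𝒜.R
  /-- The coordinates. -/
  χ : ι → 𝒜.R → k
  e_mul_e : ∀ i, e i * e i = e i
  sum_e : ∑ i, e i = 1
  mul_e : ∀ r i, r * e i = χ i r • e i
  e_mul : ∀ r i, e i * r = χ i r • e i

theorem exists_layerIdempotents {n : ℕ} (φ : 𝒜.R ≃ₐ[k] (Fin n → k)) :
    Nonempty (𝒜.LayerIdempotents (Fin n)) := by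
  refine ⟨⟨fun i => φ.symm (Pi.single i 1), fun i r => φ r i, fun i => ?_, ?_, fun r i => ?_,
    fun r i => ?_⟩⟩
  · rw [← map_mul, ← Pi.single_mul, one_mul]
  · rw [← map_sum]
    have : (∑ i, Pi.single i 1 : Fin n → k) = 1 := Finset.univ_sum_single 1
    rw [this, map_one]
  · apply φ.injective
    ext j
    by_cases h : j = i
    · subst h; simp
    · simp [h]
  · apply φ.injective
    ext j
    by_cases h : j = i
    · subst h; simp
    · simp [h]

theorem ofR_mul_smul {M : 𝒜.FGMod} (r s : 𝒜.R) (m : M) :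
    ofR (r * s) • m = ofR r • ofR s • m := by
  rw [← mul_smul]
  rfl

theorem ofR_smul_smul {M : 𝒜.FGMod} (c : k) (s : 𝒜.R) (m : M) :
    ofR (c • s) • m = c • ofR s • m := by
  rw [← smul_assoc]
  rfl

theorem mulW₁_mulW₁ (r r' : 𝒜.R) (w : 𝒜.W₁) (s s' : 𝒜.R) :
    mulW₁ r (mulW₁ r' w s) s' = mulW₁ (r * r') w (s * s') :=
  Subtype.ext (by simp only [mulW₁, MulMemClass.coe_mul, mul_assoc])

theorem mulW₁_smul_smul (c d : k) (r : 𝒜.R) (w : 𝒜.W₁) (s : 𝒜.R) :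
    mulW₁ (c • r) w (d • s) = c • d • mulW₁ r w s :=
  Subtype.ext (by simp [mulW₁, smul_comm d c])

variable {ι : Type} [Fintype ι] (D : 𝒜.LayerIdempotents ι)

namespace LayerIdempotents

theorem sum_mulW₁ (w : 𝒜.W₁) : ∑ i, ∑ j, mulW₁ (D.e i) w (D.e j) = w := by
  have h1 := congrArg (fun r : 𝒜.R => (r : 𝒜.T)) D.sum_e
  simp only [AddSubmonoidClass.coe_finsetSum, OneMemClass.coe_one] at h1
  refine Subtype.ext ?_
  simp only [AddSubmonoidClass.coe_finsetSum, mulW₁]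
  simp only [← Finset.mul_sum, ← Finset.sum_mul, h1, one_mul, mul_one]

/-- The averaging of a linear map `W₁ → Hom_k(M, N)` to a bimodule map `V → Hom_k(M, N)`. -/
theorem exists_average {M N : 𝒜.FGMod} (ψ : 𝒜.W₁ →ₗ[k] (M →ₗ[k] N)) :
    ∃ f : 𝒜.BimodHom M N, ∀ w m, f.1 (ofW₁ w) m =
      ∑ i, ∑ j, ofR (D.e i) • ψ (mulW₁ (D.e i) w (D.e j)) (ofR (D.e j) • m) := by
  let l (i j : ι) : 𝒜.W₁ →ₗ[k] 𝒜.W₁ :=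
    { toFun := fun w => mulW₁ (D.e i) w (D.e j)
      map_add' := fun w w' => Subtype.ext (by simp [mulW₁, mul_add, add_mul])
      map_smul' := fun c w => Subtype.ext (by simp [mulW₁]) }
  let Ψ : 𝒜.W₁ →ₗ[k] (M →ₗ[k] N) := ∑ i, ∑ j, (LinearMap.compRight k (Algebra.lsmul k k N (ofR (D.e i)))) ∘ₗ
    (LinearMap.lcomp k N (Algebra.lsmul k k M (ofR (D.e j)))) ∘ₗ ψ ∘ₗ l i j
  have hΨ : ∀ w m, Ψ w m =
      ∑ i, ∑ j, ofR (D.e i) • ψ (mulW₁ (D.e i) w (D.e j)) (ofR (D.e j) • m) := by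
    intro w m
    simp only [Ψ, LinearMap.sum_apply]
    rfl
  -- In the `(i, j)` summand `r` and `s` act through the scalars `D.χ i r` and `D.χ j s`, on either
  -- side of `ψ`. Each summand is therefore `R`-`R`-linear although `ψ` is only `k`-linear.
  obtain ⟨f, hf⟩ := BimodHom.exists_of_W₁ Ψ (fun r w s m => by
    rw [hΨ, hΨ, Finset.smul_sum]
    refine Finset.sum_congr rfl fun i _ => ?_
    rw [Finset.smul_sum]
    refine Finset.sum_congr rfl fun j _ => ?_
    have e1 : ofR (D.e j) • ofR s • m = D.χ j s • ofR (D.e j) • m := by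
      rw [← ofR_mul_smul, D.e_mul, ofR_smul_smul]
    have e2 : ∀ n : N, ofR r • ofR (D.e i) • n = D.χ i r • ofR (D.e i) • n := fun n => by
      rw [← ofR_mul_smul, D.mul_e, ofR_smul_smul]
    rw [mulW₁_mulW₁, D.e_mul, D.mul_e, mulW₁_smul_smul, e1, e2, map_smul ψ, map_smul ψ,
      LinearMap.smul_apply, LinearMap.smul_apply, map_smul (ψ _) (D.χ j s),
      smul_algebra_smul_comm (D.χ i r)])
  exact ⟨f, fun w m => by rw [hf, hΨ]⟩

/-- Averaging fixes the maps that are already bimodule maps, so it is a projection onto them. -/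
theorem average_apply {M N : 𝒜.FGMod} (f : 𝒜.BimodHom M N) (w : 𝒜.W₁) (m : M) :
    ∑ i, ∑ j, ofR (D.e i) • f.1 (ofW₁ (mulW₁ (D.e i) w (D.e j))) (ofR (D.e j) • m) =
      f.1 (ofW₁ w) m := by
  have : ∀ i j, ofR (D.e i) • f.1 (ofW₁ (mulW₁ (D.e i) w (D.e j))) (ofR (D.e j) • m) =
      f.1 (ofW₁ (mulW₁ (D.e i) w (D.e j))) m := fun i j => by
    rw [BimodHom.apply_mulW₁, BimodHom.apply_mulW₁, ← ofR_mul_smul, ← ofR_mul_smul, D.e_mul_e,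
      D.e_mul_e]
  simp only [this]
  have h2 : ∀ w w' : 𝒜.W₁, ofW₁ (w + w') = ofW₁ w + ofW₁ w' := fun _ _ => rfl
  let L : 𝒜.W₁ →+ N := AddMonoidHom.mk' (fun w => f.1 (ofW₁ w) m) fun w w' => by
    rw [h2, map_add, LinearMap.add_apply]
  conv_rhs => rw [← D.sum_mulW₁ w]
  change _ = L _
  simp only [map_sum]
  rfl

end LayerIdempotents

end InterlacedWeakDitalgebra

/-! ### Morphisms out of the regular module and the dual basis of `Γ`. -/

namespace InterlacedWeakDitalgebra

open WeakDitalgebra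

variable {k : Type u} [Field k] {𝒜 : InterlacedWeakDitalgebra k}

variable (𝒜) in
/-- The unit element of the regular module. -/
def one : 𝒜.regular := (1 : 𝒜.Abar)

variable (𝒜) in
/-- The linear map `A̲ → M`, `a ↦ a m`. -/
def rho {M : Type u} [AddCommGroup M] [Module 𝒜.Abar M] (m : M) : 𝒜.regular →ₗ[𝒜.Abar] M :=
  show 𝒜.Abar →ₗ[𝒜.Abar] M from LinearMap.toSpanSingleton 𝒜.Abar M m

section Rho

variable {M N : Type u} [AddCommGroup M] [Module 𝒜.Abar M] [AddCommGroup N] [Module 𝒜.Abar N]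

theorem rho_one (m : M) : 𝒜.rho m (one 𝒜) = m := one_smul 𝒜.Abar m

theorem exists_smul_one (x : 𝒜.regular) : ∃ a : 𝒜.A, a • one 𝒜 = x := by
  obtain ⟨a, ha⟩ := Ideal.Quotient.mk_surjective (I := 𝒜.I) x
  exact ⟨a, (mul_one (M := 𝒜.Abar) _).trans ha⟩

theorem regular_linearMap_ext {φ ψ : 𝒜.regular →ₗ[𝒜.Abar] M} (h : φ (one 𝒜) = ψ (one 𝒜)) :
    φ = ψ := by
  refine LinearMap.ext fun x => ?_
  obtain ⟨a, rfl⟩ := exists_smul_one x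
  rw [FGMod.A_smul_def, map_smul, map_smul, h]

theorem comp_rho (φ : M →ₗ[𝒜.Abar] N) (m : M) : φ ∘ₗ 𝒜.rho m = 𝒜.rho (φ m) :=
  regular_linearMap_ext (by rw [LinearMap.comp_apply, rho_one, rho_one])

theorem apply_rho (φ : M →ₗ[𝒜.Abar] N) (m : M) (b : 𝒜.regular) : φ (𝒜.rho m b) = 𝒜.rho (φ m) b :=
  LinearMap.congr_fun (comp_rho φ m) b

theorem rho_add (m m' : M) (b : 𝒜.regular) : 𝒜.rho (m + m') b = 𝒜.rho m b + 𝒜.rho m' b :=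
  smul_add (M := 𝒜.Abar) b m m'

variable (𝒜) in
/-- The right multiplication by `a` on `A̲`. -/
def rmulBar (a : 𝒜.Abar) : 𝒜.regular →ₗ[𝒜.Abar] 𝒜.regular := 𝒜.rho (M := 𝒜.regular) a

theorem rho_rmulBar (m : M) (a : 𝒜.Abar) : 𝒜.rho m ∘ₗ 𝒜.rmulBar a = 𝒜.rho (a • m) :=
  comp_rho (M := 𝒜.regular) (𝒜.rho m) a

theorem rho_rmulBar_apply (m : M) (a : 𝒜.Abar) (b : 𝒜.regular) :
    𝒜.rho m (𝒜.rmulBar a b) = 𝒜.rho (a • m) b :=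
  LinearMap.congr_fun (rho_rmulBar m a) b

theorem rmulBar_one (a : 𝒜.Abar) : 𝒜.rmulBar a (one 𝒜) = a := rho_one (M := 𝒜.regular) a

end Rho

namespace Hom

variable {M N L : 𝒜.FGMod}

theorem comp_ofLinear_f1 (h : Hom M N) (φ : N →ₗ[𝒜.Abar] L) (v : 𝒜.V) (m : M) :
    (comp (ofLinear φ : Hom N L) h).f1.1 v m = φ (h.f1.1 v m) := by
  change φ (h.f1.1 v m) + 0 + star (0 : 𝒜.BimodHom N L) h.f1 (𝒜.δ₁ v) m = _
  rw [star_zero_left, LinearMap.zero_apply, LinearMap.zero_apply, add_zero, add_zero]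

theorem ofLinear_comp_f0 (φ : M →ₗ[𝒜.Abar] N) (h : Hom N L) (m : M) :
    (comp h (ofLinear φ : Hom M N)).f0 m = h.f0 (φ m) := rfl

theorem ofLinear_comp_f1 (φ : M →ₗ[𝒜.Abar] N) (h : Hom N L) (v : 𝒜.V) (m : M) :
    (comp h (ofLinear φ : Hom M N)).f1.1 v m = h.f1.1 v (φ m) := by
  change h.f0 0 + h.f1.1 v (φ m) + star h.f1 (0 : 𝒜.BimodHom M N) (𝒜.δ₁ v) m = _
  rw [star_zero_right, LinearMap.zero_apply, LinearMap.zero_apply, add_zero, map_zero, zero_add]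

variable (M N) in
/-- The additive map `f ↦ f⁰`. -/
def f0Hom : Hom M N →+ (M →ₗ[k] N) := AddMonoidHom.mk' f0 fun _ _ => rfl

variable (M N) in
/-- The additive map `f ↦ f¹`. -/
def f1Hom : Hom M N →+ 𝒜.BimodHom M N := AddMonoidHom.mk' f1 fun _ _ => rfl

/-- A morphism from `A̲` is determined by `f⁰(1)` and `f¹`. -/
theorem regular_ext {h h' : Hom 𝒜.regular N} (h0 : h.f0 (one 𝒜) = h'.f0 (one 𝒜))
    (h1 : h.f1 = h'.f1) : h = h' := by
  refine ext' (fun x => ?_) fun v m => by rw [h1]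
  obtain ⟨a, rfl⟩ := exists_smul_one x
  have e := h.comm a (one 𝒜)
  rw [h0, h'.comm, h1] at e
  exact (add_right_cancel e).symm

end Hom

/-- By interlacing `δ(I) ⊆ IV + VI`, and `I` acts as zero on both modules. This lets `f⁰` be defined
on `A̲` rather than on `A`. -/
theorem BimodHom.apply_δ₀ {M N : 𝒜.FGMod} (f : 𝒜.BimodHom M N) {a : 𝒜.A} (ha : a ∈ 𝒜.I) :
    f.1 (𝒜.δ₀ a) = 0 := by
  have hle : 𝒜.idealSub 𝒜.I * 𝒜.V ⊔ 𝒜.V * 𝒜.idealSub 𝒜.I ≤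
      Submodule.map 𝒜.V.subtype (LinearMap.ker f.1) := by
    refine sup_le (Submodule.mul_le.2 fun i hi v hv => ?_) (Submodule.mul_le.2 fun v hv i hi => ?_)
    · obtain ⟨j, hj, rfl⟩ := mem_idealSub hi
      refine ⟨𝒜.lmul j ⟨v, hv⟩, LinearMap.ext fun m => ?_, rfl⟩
      rw [f.2.1, FGMod.smul_of_mem hj]; rfl
    · obtain ⟨j, hj, rfl⟩ := mem_idealSub hi
      refine ⟨𝒜.rmul ⟨v, hv⟩ j, LinearMap.ext fun m => ?_, rfl⟩
      rw [f.2.2, FGMod.smul_of_mem hj, map_zero]; rfl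
  obtain ⟨w, hw, hwv⟩ := hle (𝒜.interlaced.δ_I ⟨a, ⟨a, ha, rfl⟩, rfl⟩)
  have : w = 𝒜.δ₀ a := Subtype.ext hwv
  subst this
  exact hw

/-- Every pair `(f⁰(1), f¹)` comes from a morphism from `A̲`. -/
theorem exists_hom_regular {N : 𝒜.FGMod} (n : N) (f : 𝒜.BimodHom 𝒜.regular N) :
    ∃ h : Hom 𝒜.regular N, h.f0 (one 𝒜) = n ∧ h.f1 = f := by
  let d : 𝒜.A →ₗ[k] 𝒜.V :=
    { toFun := 𝒜.δ₀
      map_add' := fun a b => Subtype.ext (map_add 𝒜.δ _ _)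
      map_smul' := fun c a => Subtype.ext (map_smul 𝒜.δ _ _) }
  -- The only value that compatibility allows for `f⁰` at the class of `a`.
  let g : 𝒜.A →ₗ[k] N :=
    (LinearMap.toSpanSingleton 𝒜.A N n).restrictScalars k - f.1.flip (one 𝒜) ∘ₗ d
  have hg : ∀ a, g a = a • n - f.1 (𝒜.δ₀ a) (one 𝒜) := fun _ => rfl
  have hgI : ∀ a ∈ 𝒜.I, g a = 0 := fun a ha => by
    rw [hg, BimodHom.apply_δ₀ f ha, FGMod.smul_of_mem ha, LinearMap.zero_apply, sub_zero]
  let q : 𝒜.A →ₗ[k] 𝒜.regular := (LinearMap.toSpanSingleton 𝒜.A 𝒜.regular (one 𝒜)).restrictScalars k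
  have hq : ∀ a, q a = a • one 𝒜 := fun _ => rfl
  have hqI : ∀ a, q a = 0 → a ∈ 𝒜.I := fun a ha =>
    Ideal.Quotient.eq_zero_iff_mem.1 ((mul_one (M := 𝒜.Abar) _).symm.trans ha)
  -- A `k`-linear section of `A → A̲`, used only to descend `g`; the result is independent of it
  -- because `g` kills `I`.
  obtain ⟨s, hs⟩ := q.exists_rightInverse_of_surjective
    (LinearMap.range_eq_top.2 fun x => exists_smul_one x)
  have hs' : ∀ a : 𝒜.A, g (s (a • one 𝒜)) = g a := by
    intro a
    rw [← sub_eq_zero, ← map_sub]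
    apply hgI
    apply hqI
    rw [map_sub, hq a, sub_eq_zero]
    exact LinearMap.congr_fun hs _
  refine ⟨⟨g ∘ₗ s, f, fun b x => ?_⟩, ?_, rfl⟩
  · obtain ⟨a, rfl⟩ := exists_smul_one x
    rw [LinearMap.comp_apply, LinearMap.comp_apply, ← mul_smul, hs', hs', hg, hg, ← f.2.2]
    have e : 𝒜.δ₀ (b * a) = 𝒜.rmul (𝒜.δ₀ b) a + 𝒜.lmul b (𝒜.δ₀ a) := by
      refine Subtype.ext ?_
      have := 𝒜.leibniz (m := 0) b.2 (a : 𝒜.T)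
      rw [pow_zero, one_mul] at this
      exact this
    rw [e, map_add, LinearMap.add_apply, f.2.1 b, smul_sub, mul_smul]
    abel
  · have := hs' 1
    rw [one_smul] at this
    refine this.trans ?_
    have h1 : 𝒜.δ₀ 1 = 0 := Subtype.ext (𝒜.δ_R (one_mem 𝒜.R))
    rw [hg, h1, map_zero, LinearMap.zero_apply, sub_zero, one_smul]

theorem sum_coord_smul_coord_smul {X Y Z J L : Type*} [AddCommGroup X] [Module k X]
    [AddCommGroup Y] [Module k Y] [AddCommGroup Z] [Module k Z] [Fintype J] [Fintype L]
    (b : Module.Basis J k X) (b' : Module.Basis L k Y) (f : X →ₗ[k] Y →ₗ[k] Z) (x : X) (y : Y) :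
    ∑ p : J × L, (b.coord p.1 x * b'.coord p.2 y) • f (b p.1) (b' p.2) = f x y := by
  conv_rhs => rw [← b.sum_repr x, ← b'.sum_repr y]
  simp only [map_sum, LinearMap.sum_apply, map_smul, LinearMap.smul_apply, Fintype.sum_prod_type,
    mul_smul, Module.Basis.coord_apply]
  rw [Finset.sum_comm]
  simp only [Finset.smul_sum]
  exact Finset.sum_congr rfl fun j _ => Finset.sum_congr rfl fun l _ => smul_comm _ _ _

variable (𝒜) in
/-- A finite family of elements of `Γ` through which all morphisms from `A̲` are expressed, with
coordinates which are compatible with the morphisms `(φ, 0)`. For the morphisms `A̲ → A̲` this is a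
dual basis of the right `A̲`-module `Γ`. -/
structure RegularBasis (ι : Type) [Fintype ι] where
  /-- The elements of `Γ`. -/
  γ : ι → Hom 𝒜.regular 𝒜.regular
  /-- The coordinates. -/
  c : ∀ N : 𝒜.FGMod, ι → Hom 𝒜.regular N →+ N
  c_comp : ∀ {N N' : 𝒜.FGMod} (φ : N →ₗ[𝒜.Abar] N') (i : ι) (h : Hom 𝒜.regular N),
    c N' i (Hom.comp (ofLinear φ : Hom N N') h) = φ (c N i h)
  sum_eq : ∀ {N : 𝒜.FGMod} (h : Hom 𝒜.regular N),
    ∑ i, Hom.comp (ofLinear (𝒜.rho (c N i h)) : Hom 𝒜.regular N) (γ i) = h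

/-- A morphism `h` from `A̲` is given by `h⁰(1)` and `h¹`. The restriction of `h¹` to `W₁ × A̲`
expands in `k`-bases of both factors with the values of `h¹` on basis pairs as coefficients in `N`.
Averaging the elementary maps turns this expansion into one by elements of `Γ` without changing
`h¹`. -/
theorem exists_regularBasis (h𝒜 : 𝒜.IsSpecial) :
    ∃ (ι : Type) (_ : Fintype ι), Nonempty (𝒜.RegularBasis ι) := by
  obtain ⟨n, ⟨φ⟩⟩ := h𝒜.layer_eq
  obtain ⟨D⟩ := exists_layerIdempotents φ
  have := h𝒜.finite_W₁
  have := h𝒜.finite_Abar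
  have : Module.Finite k 𝒜.regular := Module.Finite.trans 𝒜.Abar 𝒜.regular
  let b := Module.finBasis k 𝒜.W₁
  let b' := Module.finBasis k 𝒜.regular
  -- The average of the elementary map that sends `w` and `m` to the product of their coordinates
  -- times `1`. Its lift `γ p` is chosen with `f⁰(1) = 0`, so that it contributes only to the second
  -- component.
  choose F hF using fun p : Fin _ × Fin _ => D.exists_average (M := 𝒜.regular) (N := 𝒜.regular)
    ((b.coord p.1).smulRight ((b'.coord p.2).smulRight (one 𝒜)))
  choose γ hγ0 hγ1 using fun p : Fin _ × Fin _ => exists_hom_regular (0 : 𝒜.regular) (F p)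
  let c0 (N : 𝒜.FGMod) : Hom 𝒜.regular N →+ N :=
    AddMonoidHom.mk' (fun h => h.f0 (one 𝒜)) fun _ _ => rfl
  let c1 (N : 𝒜.FGMod) (p : Fin _ × Fin _) : Hom 𝒜.regular N →+ N :=
    AddMonoidHom.mk' (fun h => h.f1.1 (ofW₁ (b p.1)) (b' p.2)) fun _ _ => rfl
  -- The index `none` stands for the identity of `A̲`, whose coordinate is `h⁰(1)`.
  refine ⟨Option (Fin _ × Fin _), inferInstance, ⟨⟨fun i => i.elim (Hom.id 𝒜.regular) γ,
    fun N i => i.elim (c0 N) (c1 N), fun {N N'} φ i h => ?_, fun {N} h => ?_⟩⟩⟩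
  · cases i with
    | none => rfl
    | some p => exact Hom.comp_ofLinear_f1 h φ _ _
  · rw [Fintype.sum_option]
    apply Hom.regular_ext
    · change Hom.f0Hom _ _ (_ + _) (one 𝒜) = _
      rw [map_add, map_sum, LinearMap.add_apply, LinearMap.sum_apply]
      have : ∀ p : Fin _ × Fin _, Hom.f0Hom _ _
          (Hom.comp (ofLinear (𝒜.rho (c1 N p h)) : Hom 𝒜.regular N) (γ p)) (one 𝒜) = 0 := fun p => by
        change 𝒜.rho (c1 N p h) ((γ p).f0 (one 𝒜)) = 0
        rw [hγ0, map_zero]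
      refine (congrArg₂ (· + ·) (rho_one (h.f0 (one 𝒜)))
        (Finset.sum_eq_zero fun p _ => this p)).trans (add_zero _)
    · apply BimodHom.ext_W₁
      intro w m
      let ev : 𝒜.BimodHom 𝒜.regular N →+ N :=
        AddMonoidHom.mk' (fun f => f.1 (ofW₁ w) m) fun _ _ => rfl
      change ev (Hom.f1Hom _ _ (_ + _)) = _
      rw [map_add, map_add, map_sum, map_sum]
      have e0 : ev (Hom.f1Hom _ _ (Hom.comp (ofLinear (𝒜.rho (c0 N h)) : Hom 𝒜.regular N)
          (Hom.id 𝒜.regular))) = 0 :=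
        (Hom.comp_ofLinear_f1 (Hom.id 𝒜.regular) (𝒜.rho (c0 N h)) (ofW₁ w) m).trans (map_zero _)
      have e1 : ∀ p, ev (Hom.f1Hom _ _ (Hom.comp (ofLinear (𝒜.rho (c1 N p h)) : Hom 𝒜.regular N)
          (γ p))) = ∑ i, ∑ j, ofR (D.e i) • (b.coord p.1 (mulW₁ (D.e i) w (D.e j)) *
            b'.coord p.2 (ofR (D.e j) • m)) • h.f1.1 (ofW₁ (b p.1)) (b' p.2) := by
        intro p
        refine (Hom.comp_ofLinear_f1 (γ p) (𝒜.rho (c1 N p h)) (ofW₁ w) m).trans ?_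
        rw [hγ1, hF, map_sum]
        refine Finset.sum_congr rfl fun i _ => ?_
        rw [map_sum]
        refine Finset.sum_congr rfl fun j _ => ?_
        rw [FGMod.A_smul_def, map_smul, FGMod.A_smul_def, LinearMap.smulRight_apply,
          LinearMap.smul_apply, LinearMap.smulRight_apply, ← mul_smul]
        have : ∀ t : k, 𝒜.rho (c1 N p h) (t • one 𝒜) = t • c1 N p h := fun t => by
          rw [← LinearMap.coe_restrictScalars k, map_smul, LinearMap.coe_restrictScalars, rho_one]
        rw [this]
        rfl
      refine (congrArg₂ (· + ·) e0 (Finset.sum_congr rfl fun p _ => e1 p)).trans ?_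
      -- With `h.f1` written as its own average, the two sides agree for each pair of idempotents by
      -- the expansion of a bilinear map in the bases `b` and `b'`.
      rw [zero_add, Finset.sum_comm, ← D.average_apply h.f1 w m]
      refine Finset.sum_congr rfl fun i _ => ?_
      rw [Finset.sum_comm]
      refine Finset.sum_congr rfl fun j _ => ?_
      rw [← Finset.smul_sum]
      let incl : 𝒜.W₁ →ₗ[k] 𝒜.V := Submodule.inclusion 𝒜.W₁_le
      exact congrArg _ (sum_coord_smul_coord_smul b b' (h.f1.1 ∘ₗ incl) _ _)

end InterlacedWeakDitalgebra

/-! ### The comparison `Γ ⊗ N ≅ Hom_𝒜(A̲, N)`; `F` is full, faithful and exact. -/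

namespace InterlacedWeakDitalgebra

open WeakDitalgebra

variable {k : Type u} [Field k] {𝒜 : InterlacedWeakDitalgebra k}

theorem ofLinear_rho_smul {N : 𝒜.FGMod} (a : 𝒜.Abar) (n : N) :
    (ofLinear (𝒜.rho (a • n)) : Hom 𝒜.regular N) =
      Hom.comp (ofLinear (𝒜.rho n) : Hom 𝒜.regular N)
        (ofLinear (𝒜.rmulBar a) : Hom 𝒜.regular 𝒜.regular) := by
  rw [← rho_rmulBar]
  exact ofLinear_comp (𝒜.rmulBar a) (𝒜.rho n)

theorem ofLinear_rho_add {N : 𝒜.FGMod} (n n' : N) :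
    (ofLinear (𝒜.rho (n + n')) : Hom 𝒜.regular N) =
      (ofLinear (𝒜.rho n) : Hom 𝒜.regular N) + (ofLinear (𝒜.rho n') : Hom 𝒜.regular N) :=
  Hom.ext' (fun m => rho_add n n' m) fun _ _ => (add_zero _).symm

/-- The natural map `Γ ⊗_{A̲} N ⟶ Hom_𝒜(A̲, N)`. -/
noncomputable def tensorΓToF (N : 𝒜.FGMod) :
    𝒜.tensorΓ.obj (ModuleCat.of 𝒜.Abar N) ⟶ 𝒜.F.obj N :=
  extendScalarsLift 𝒜.toΓ (ModuleCat.ofHom (X := N)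
    (Y := (ModuleCat.restrictScalars 𝒜.toΓ).obj (𝒜.F.obj N))
    { toFun := fun n => (ofLinear (𝒜.rho n) : Hom 𝒜.regular N)
      map_add' := ofLinear_rho_add
      map_smul' := ofLinear_rho_smul })

theorem tensorΓToF_one_tmul {N : 𝒜.FGMod} (n : N) :
    tensorΓToF N (inducedTmul (M := ModuleCat.of 𝒜.Abar N) 𝒜.toΓ 1 n) =
      (ofLinear (𝒜.rho n) : Hom 𝒜.regular N) :=
  one_smul 𝒜.Γ ((ofLinear (𝒜.rho n) : Hom 𝒜.regular N) : 𝒜.F.obj N)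

theorem tensorΓToF_naturality {M N : 𝒜.FGMod} (φ : M →ₗ[𝒜.Abar] N) :
    𝒜.tensorΓ.map (ModuleCat.ofHom φ) ≫ tensorΓToF N = tensorΓToF M ≫ 𝒜.F.map (ofLinear φ) := by
  refine extendScalarsFunctor_hom_ext _ fun m => ?_
  change tensorΓToF N (inducedTmul (M := ModuleCat.of 𝒜.Abar N) 𝒜.toΓ 1 (φ m)) =
    (𝒜.F.map (ofLinear φ)) (tensorΓToF M (inducedTmul (M := ModuleCat.of 𝒜.Abar M) 𝒜.toΓ 1 m))
  rw [tensorΓToF_one_tmul, tensorΓToF_one_tmul, ← comp_rho]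
  exact ofLinear_comp (𝒜.rho m) φ

namespace RegularBasis

variable {ι : Type} [Fintype ι] (D : 𝒜.RegularBasis ι)

include D

/-- For `N = A̲` the family is a dual basis of `Γ`: right multiplication by `a` is a morphism of the
form `(φ, 0)`, so `c_comp` is right `A̲`-linearity of the coordinates. -/
theorem exact_tensorΓ :
    Limits.PreservesFiniteLimits 𝒜.tensorΓ ∧ Limits.PreservesFiniteColimits 𝒜.tensorΓ := by
  refine extendScalarsFunctor_exact 𝒜.toΓ (fun i => MulOpposite.op (D.γ i))
    (fun i => (D.c 𝒜.regular i).comp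
      (AddMonoidHom.mk' (fun g : 𝒜.Γ => (g.unop : Hom 𝒜.regular 𝒜.regular)) fun _ _ => rfl))
    (fun i g a => ?_) fun g => ?_
  · refine (D.c_comp (𝒜.rmulBar a) i g.unop).trans ?_
    rfl
  · apply MulOpposite.unop_injective
    rw [Finset.unop_sum]
    exact D.sum_eq (N := 𝒜.regular) g.unop

/-- The inverse sends `h` to `∑ γ i ⊗ c i h`. One composite is `sum_eq` for `N`, and the other
reduces to `sum_eq` for `A̲`. -/
theorem bijective_tensorΓToF (N : 𝒜.FGMod) : Function.Bijective (tensorΓToF N) := by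
  have hsurj : ∀ h : Hom 𝒜.regular N, tensorΓToF N (∑ i, inducedTmul
      (M := ModuleCat.of 𝒜.Abar N) 𝒜.toΓ (MulOpposite.op (D.γ i)) (D.c N i h)) = h := fun h => by
    rw [map_sum]
    exact D.sum_eq h
  refine ⟨(injective_iff_map_eq_zero (tensorΓToF N).hom).2 fun x hx => ?_, fun h => ⟨_, hsurj h⟩⟩
  suffices H : ∀ x, ∑ i, inducedTmul (M := ModuleCat.of 𝒜.Abar N) 𝒜.toΓ (MulOpposite.op (D.γ i))
      (D.c N i (tensorΓToF N x)) = x by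
    rw [← H x]
    have hx' : tensorΓToF N x = 0 := hx
    rw [hx']
    refine Finset.sum_eq_zero fun i _ => ?_
    have : D.c N i (0 : 𝒜.F.obj N) = 0 := map_zero (D.c N i)
    rw [this, inducedTmul_zero]
  intro x
  induction x using inducedTmul_induction 𝒜.toΓ with
  | h0 =>
    have : ∀ i, D.c N i (0 : 𝒜.F.obj N) = 0 := fun i => map_zero (D.c N i)
    rw [map_zero]
    simp only [this, inducedTmul_zero, Finset.sum_const_zero]
  | h g n =>
    -- Naturality of the coordinates along `A̲ → N`, `a ↦ a n`, gives `c i (g ⊗ n) = c i (g) n`; the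
    -- scalar then moves across the tensor sign.
    have h1 : ∀ i, D.c N i (tensorΓToF N (inducedTmul (M := ModuleCat.of 𝒜.Abar N) 𝒜.toΓ g n)) =
        (show 𝒜.Abar from D.c 𝒜.regular i g.unop) • n := fun i =>
      (D.c_comp (𝒜.rho n) i g.unop).trans rfl
    simp only [h1]
    have h2 : ∀ i, inducedTmul (M := ModuleCat.of 𝒜.Abar N) 𝒜.toΓ (MulOpposite.op (D.γ i))
        ((show 𝒜.Abar from D.c 𝒜.regular i g.unop) • n) = _ := fun i =>
      inducedTmul_smul (M := ModuleCat.of 𝒜.Abar N) 𝒜.toΓ (MulOpposite.op (D.γ i)) _ n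
    simp only [h2]
    rw [← inducedTmul_sum]
    congr 1
    apply MulOpposite.unop_injective
    rw [Finset.unop_sum]
    exact D.sum_eq (N := 𝒜.regular) g.unop
  | ha x y hx hy =>
    have : ∀ i, D.c N i (tensorΓToF N (x + y)) =
        D.c N i (tensorΓToF N x) + D.c N i (tensorΓToF N y) := fun i => by
      rw [map_add]
      exact map_add (D.c N i) _ _
    exact (Finset.sum_congr rfl fun i _ => (congrArg _ (this i)).trans
      (inducedTmul_add (M := ModuleCat.of 𝒜.Abar N) 𝒜.toΓ _ _ _)).trans
      (Finset.sum_add_distrib.trans (congrArg₂ (· + ·) hx hy))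

/-- The isomorphism `Γ ⊗_{A̲} N ≅ Hom_𝒜(A̲, N)`. -/
noncomputable def tensorΓIso (N : 𝒜.FGMod) :
    𝒜.tensorΓ.obj (ModuleCat.of 𝒜.Abar N) ≅ 𝒜.F.obj N :=
  (LinearEquiv.ofBijective (tensorΓToF N).hom (D.bijective_tensorΓToF N)).toModuleIso

theorem tensorΓIso_hom (N : 𝒜.FGMod) : (D.tensorΓIso N).hom = tensorΓToF N := rfl

/-- The isomorphism of functors `Γ ⊗_{A̲} - ≅ Hom_𝒜(A̲, L(-))`. -/
noncomputable def tensorΓNatIso : (ModuleCat.isFG 𝒜.Abar).ι ⋙ 𝒜.tensorΓ ≅ 𝒜.L ⋙ 𝒜.F :=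
  NatIso.ofComponents (fun M => D.tensorΓIso (𝒜.L.obj M)) fun {M N} f =>
    tensorΓToF_naturality (M := 𝒜.L.obj M) (N := 𝒜.L.obj N) f.hom.hom

theorem finite_F (N : 𝒜.FGMod) : ModuleCat.isFG 𝒜.Γ (𝒜.F.obj N) := by
  have : Module.Finite 𝒜.Γ (𝒜.tensorΓ.obj (ModuleCat.of 𝒜.Abar N)) :=
    extendScalarsFunctor_finite (M := ModuleCat.of 𝒜.Abar N) 𝒜.toΓ
  exact Module.Finite.of_surjective (tensorΓToF N).hom (D.bijective_tensorΓToF N).2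

-- Precomposing with `a ↦ a m` and evaluating at `1` recovers `f⁰(m)` and `f¹(v)(m)`.
omit D in
theorem faithful_F : 𝒜.F.Faithful := by
  refine ⟨fun {M N} f g hfg => ?_⟩
  have h : ∀ m : M, Hom.comp f (ofLinear (𝒜.rho m) : Hom 𝒜.regular M) =
      Hom.comp g (ofLinear (𝒜.rho m) : Hom 𝒜.regular M) := fun m =>
    congrArg (fun t : 𝒜.F.obj M ⟶ 𝒜.F.obj N => t (ofLinear (𝒜.rho m) : Hom 𝒜.regular M)) hfg
  refine Hom.ext' (fun m => ?_) fun v m => ?_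
  · have := congrArg (fun t : Hom 𝒜.regular N => t.f0 (one 𝒜)) (h m)
    simp only [Hom.ofLinear_comp_f0, rho_one] at this
    exact this
  · have := congrArg (fun t : Hom 𝒜.regular N => t.f1.1 v (one 𝒜)) (h m)
    simp only [Hom.ofLinear_comp_f1, rho_one] at this
    exact this

/-- The value `p m` of `Φ` at `a ↦ a m`, evaluated at `1`, prescribes both components of a preimage.
Linearity of `Φ` over the image of `A̲` in `Γ` gives `p (a • m) = p m ∘ (· a)`, which is what makes
these components a morphism. -/
theorem full_F : 𝒜.F.Full := by
  refine ⟨fun {M N} Φ => ?_⟩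
  let p (m : M) : Hom 𝒜.regular N := Φ (ofLinear (𝒜.rho m) : Hom 𝒜.regular M)
  have hadd : ∀ m m', p (m + m') = p m + p m' := fun m m' => by
    have h : (ofLinear (𝒜.rho (m + m')) : Hom 𝒜.regular M) = _ := ofLinear_rho_add m m'
    exact (congrArg Φ h).trans (map_add Φ.hom _ _)
  have hsmul : ∀ (a : 𝒜.Abar) m, p (a • m) =
      Hom.comp (p m) (ofLinear (𝒜.rmulBar a) : Hom 𝒜.regular 𝒜.regular) := fun a m => by
    have h : (ofLinear (𝒜.rho (a • m)) : Hom 𝒜.regular M) = _ := ofLinear_rho_smul a m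
    exact (congrArg Φ h).trans (map_smul Φ.hom (𝒜.toΓ a)
      ((ofLinear (𝒜.rho m) : Hom 𝒜.regular M) : 𝒜.F.obj M))
  have h0 : ∀ (a : 𝒜.A) m, (p (a • m)).f0 (one 𝒜) = (p m).f0 (a • one 𝒜) := fun a m => by
    rw [FGMod.A_smul_def, hsmul, Hom.ofLinear_comp_f0, rmulBar_one, FGMod.A_smul_def]
    exact congrArg _ (mul_one (M := 𝒜.Abar) _).symm
  have h1 : ∀ (a : 𝒜.A) v m, (p (a • m)).f1.1 v (one 𝒜) = (p m).f1.1 v (a • one 𝒜) :=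
      fun a v m => by
    rw [FGMod.A_smul_def, hsmul, Hom.ofLinear_comp_f1, rmulBar_one, FGMod.A_smul_def]
    exact congrArg _ (mul_one (M := 𝒜.Abar) _).symm
  have hk : ∀ (c : k) (m : M), c • m = algebraMap k 𝒜.A c • m := fun c m => by
    rw [algebraMap_smul]
  let f : Hom M N :=
    { f0 :=
        { toFun := fun m => (p m).f0 (one 𝒜)
          map_add' := fun m m' => by rw [hadd]; rfl
          map_smul' := fun c m => by
            rw [hk, h0, algebraMap_smul, map_smul]
            rfl }
      f1 := ⟨
        { toFun := fun v =>
            { toFun := fun m => (p m).f1.1 v (one 𝒜)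
              map_add' := fun m m' => by rw [hadd]; rfl
              map_smul' := fun c m => by
                rw [hk, h1, algebraMap_smul, map_smul]
                rfl }
          map_add' := fun v w => LinearMap.ext fun m => by
            change (p m).f1.1 (v + w) (one 𝒜) = _
            rw [map_add]
            rfl
          map_smul' := fun c v => LinearMap.ext fun m => by
            change (p m).f1.1 (c • v) (one 𝒜) = _
            rw [map_smul]
            rfl },
        fun a v m => (p m).f1.2.1 a v (one 𝒜),
        fun a v m => ((p m).f1.2.2 a v (one 𝒜)).trans (h1 a v m).symm⟩
      comm := fun a m => by
        change a • (p m).f0 (one 𝒜) = (p (a • m)).f0 (one 𝒜) + (p m).f1.1 (𝒜.δ₀ a) (one 𝒜)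
        rw [h0, (p m).comm] }
  refine ⟨f, ?_⟩
  -- The morphisms `a ↦ a m` generate `Hom_𝒜(A̲, M)` over `Γ`, so it suffices to compare on them.
  have he : Epi (tensorΓToF M) := (ModuleCat.epi_iff_surjective _).2 (D.bijective_tensorΓToF M).2
  rw [← cancel_epi (tensorΓToF M)]
  refine extendScalarsFunctor_hom_ext _ fun m => ?_
  change (𝒜.F.map f) (tensorΓToF M (inducedTmul (M := ModuleCat.of 𝒜.Abar M) 𝒜.toΓ 1 m)) =
    Φ (tensorΓToF M (inducedTmul (M := ModuleCat.of 𝒜.Abar M) 𝒜.toΓ 1 m))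
  rw [tensorΓToF_one_tmul]
  refine Hom.regular_ext ?_ (Subtype.ext (LinearMap.ext fun v => LinearMap.ext fun x => ?_))
  · change (Hom.comp f (ofLinear (𝒜.rho m) : Hom 𝒜.regular M)).f0 (one 𝒜) = (p m).f0 (one 𝒜)
    rw [Hom.ofLinear_comp_f0, rho_one]
    rfl
  · change (Hom.comp f (ofLinear (𝒜.rho m) : Hom 𝒜.regular M)).f1.1 v x = (p m).f1.1 v x
    rw [Hom.ofLinear_comp_f1]
    obtain ⟨a, rfl⟩ := exists_smul_one x
    rw [← h1, FGMod.A_smul_def, map_smul, rho_one]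
    rfl

/-- Up to isomorphism a conflation is a short exact sequence of `A̲`-modules, on which `F` agrees
with the exact functor `Γ ⊗ -`. -/
theorem shortExact_F {M E N : 𝒜.FGMod} (f : M ⟶ E) (g : E ⟶ N) (hfg : IsConflation f g) :
    ∃ w : 𝒜.F.map f ≫ 𝒜.F.map g = 0, (ShortComplex.mk (𝒜.F.map f) (𝒜.F.map g) w).ShortExact := by
  obtain ⟨M', E', N', φ, ψ, a, b, c, hφ, hψ, ⟨-, -, hinj, hex, s, -, hs⟩, hf, hg⟩ := hfg
  -- If `f¹ = 0`, the compatibility condition says exactly that `f⁰` is `A`-linear.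
  have hlin : ∀ {X Y : 𝒜.FGMod} (t : Hom X Y), t.f1 = 0 →
      ∃ l : X →ₗ[𝒜.Abar] Y, t = ofLinear l ∧ ∀ x, l x = t.f0 x := by
    intro X Y t ht
    refine ⟨{ t.f0 with
      map_smul' := fun r x => ?_ }, Hom.ext' (fun _ => rfl) fun v x => by rw [ht]; rfl, fun _ => rfl⟩
    obtain ⟨r, rfl⟩ := Ideal.Quotient.mk_surjective r
    have := t.comm r x
    rw [ht] at this
    exact (this.trans (add_zero _)).symm
  obtain ⟨φ', hφ', hφ0⟩ := hlin φ hφ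
  obtain ⟨ψ', hψ', hψ0⟩ := hlin ψ hψ
  have hz : ModuleCat.ofHom φ' ≫ ModuleCat.ofHom ψ' = 0 := ModuleCat.hom_ext (LinearMap.ext fun m => by
    change ψ' (φ' m) = 0
    rw [hφ0, hψ0, hex.apply_apply_eq_zero])
  have hS : (ShortComplex.mk _ _ hz).ShortExact := by
    refine { exact := ?_, mono_f := ?_, epi_g := ?_ }
    · rw [ShortComplex.moduleCat_exact_iff]
      intro x hx
      obtain ⟨y, hy⟩ := (hex x).1 ((hψ0 x).symm.trans hx)
      exact ⟨y, (hφ0 y).trans hy⟩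
    · exact (ModuleCat.mono_iff_injective _).2 fun x y hxy =>
        hinj ((hφ0 x).symm.trans (Eq.trans hxy (hφ0 y)))
    · exact (ModuleCat.epi_iff_surjective _).2 fun n => ⟨s n, (hψ0 _).trans (hs n)⟩
  obtain ⟨hl, hr⟩ := D.exact_tensorΓ
  have hFS := hS.map_of_exact 𝒜.tensorΓ
  have e1 : 𝒜.F.map f ≫ (𝒜.F.mapIso b ≪≫ (D.tensorΓIso E').symm).hom =
      (𝒜.F.mapIso a ≪≫ (D.tensorΓIso M').symm).hom ≫ 𝒜.tensorΓ.map (ModuleCat.ofHom φ') := by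
    have h := tensorΓToF_naturality φ'
    rw [← D.tensorΓIso_hom, ← D.tensorΓIso_hom, ← hφ', ← Iso.inv_comp_eq] at h
    simp only [Iso.trans_hom, Functor.mapIso_hom, Iso.symm_hom, Category.assoc]
    rw [← Functor.map_comp_assoc, hf, Functor.map_comp_assoc]
    congr 1
    rw [Iso.comp_inv_eq, Category.assoc]
    exact h.symm
  have e2 : 𝒜.F.map g ≫ (𝒜.F.mapIso c ≪≫ (D.tensorΓIso N').symm).hom =
      (𝒜.F.mapIso b ≪≫ (D.tensorΓIso E').symm).hom ≫ 𝒜.tensorΓ.map (ModuleCat.ofHom ψ') := by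
    have h := tensorΓToF_naturality ψ'
    rw [← D.tensorΓIso_hom, ← D.tensorΓIso_hom, ← hψ', ← Iso.inv_comp_eq] at h
    simp only [Iso.trans_hom, Functor.mapIso_hom, Iso.symm_hom, Category.assoc]
    rw [← Functor.map_comp_assoc, hg, Functor.map_comp_assoc]
    congr 1
    rw [Iso.comp_inv_eq, Category.assoc]
    exact h.symm
  have w : 𝒜.F.map f ≫ 𝒜.F.map g = 0 := by
    rw [← cancel_mono (𝒜.F.mapIso c ≪≫ (D.tensorΓIso N').symm).hom, Category.assoc, e2,
      ← Category.assoc, e1, Category.assoc, ← Functor.map_comp, hz, Functor.map_zero,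
      Limits.comp_zero, Limits.zero_comp]
  exact ⟨w, ShortComplex.shortExact_of_iso (ShortComplex.isoMk _ _ _ e1.symm e2.symm).symm hFS⟩

end RegularBasis

end InterlacedWeakDitalgebra

/-! ### The injective cokernel of the unit, and its consequences for `ℐ` and `Ext`. -/

namespace InterlacedWeakDitalgebra

open WeakDitalgebra

variable {k : Type u} [Field k] {𝒜 : InterlacedWeakDitalgebra k}

/-- The `A̲`-module `Hom_{A-A}(V, Hom_k(A̲, N))`, with the action induced by the right action of `A̲`
on itself. -/
def RegularBimodHom (N : 𝒜.FGMod) : Type u := 𝒜.BimodHom 𝒜.regular N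

namespace RegularBimodHom

variable {N : 𝒜.FGMod}

instance : AddCommGroup (RegularBimodHom N) := inferInstanceAs (AddCommGroup (𝒜.BimodHom 𝒜.regular N))

/-- The underlying linear map. -/
def val (f : RegularBimodHom N) : 𝒜.V →ₗ[k] (𝒜.regular →ₗ[k] N) := f.1

theorem ext {f g : RegularBimodHom N} (h : ∀ v m, f.val v m = g.val v m) : f = g :=
  Subtype.ext (LinearMap.ext fun v => LinearMap.ext fun m => h v m)

instance : SMul 𝒜.Abar (RegularBimodHom N) :=
  ⟨fun a f => ⟨LinearMap.lcomp k N ((𝒜.rmulBar a).restrictScalars k) ∘ₗ f.val,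
    fun b v m => f.2.1 b v (𝒜.rmulBar a m), fun b v m => by
      change f.val (𝒜.rmul v b) (𝒜.rmulBar a m) = f.val v (𝒜.rmulBar a (b • m))
      rw [FGMod.A_smul_def, map_smul]
      exact f.2.2 b v (𝒜.rmulBar a m)⟩⟩

theorem smul_val (a : 𝒜.Abar) (f : RegularBimodHom N) (v : 𝒜.V) (m : 𝒜.regular) :
    (a • f).val v m = f.val v (𝒜.rmulBar a m) := rfl

instance : Module 𝒜.Abar (RegularBimodHom N) where
  one_smul f := ext fun v m => congrArg (f.val v) (mul_one (M := 𝒜.Abar) m)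
  mul_smul a b f := ext fun v m => congrArg (f.val v) (mul_assoc (G := 𝒜.Abar) m a b).symm
  smul_zero _ := ext fun _ _ => rfl
  smul_add _ _ _ := ext fun _ _ => rfl
  add_smul a b f := ext fun v m =>
    (congrArg (f.val v) (mul_add (R := 𝒜.Abar) m a b)).trans (map_add (f.val v) _ _)
  zero_smul f := ext fun v m =>
    (congrArg (f.val v) (mul_zero (M₀ := 𝒜.Abar) m)).trans (map_zero (f.val v))

open scoped ModuleCat.Algebra in
/-- The module `Hom_{A-A}(V, Hom_k(A̲, N))` is injective. -/
theorem injective {ι : Type} [Fintype ι] (D : 𝒜.LayerIdempotents ι) (N : 𝒜.FGMod) :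
    Injective (ModuleCat.of 𝒜.Abar (RegularBimodHom N)) := by
  refine ⟨fun {X Y} u f hf => ?_⟩
  have hf' := (ModuleCat.mono_iff_injective f).1 hf
  have hval : ∀ (a : 𝒜.Abar) (x : X) v b, (u (a • x)).val v b = (u x).val v (𝒜.rmulBar a b) := by
    intro a x v b
    rw [map_smul]
    exact smul_val a (u x) v b
  have hk : ∀ (c : k) (x : X), c • x = algebraMap k 𝒜.Abar c • x := fun c x => by
    rw [algebraMap_smul]
  have hone : ∀ c : k, 𝒜.rmulBar (algebraMap k 𝒜.Abar c) (one 𝒜) = c • one 𝒜 := fun c => by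
    rw [rmulBar_one, ← algebraMap_smul 𝒜.Abar c (one 𝒜)]
    exact (mul_one (M := 𝒜.Abar) _).symm
  -- Evaluation at `1` turns an `A̲`-linear map into the coinduced module `Hom_k(A̲, Hom_k(W₁, N))`
  -- into a `k`-linear map to `Hom_k(W₁, N)`, which extends along `f` by a `k`-linear retraction.
  let u' : X →ₗ[k] (𝒜.W₁ →ₗ[k] N) :=
    { toFun := fun x =>
        { toFun := fun w => (u x).val (ofW₁ w) (one 𝒜)
          map_add' := fun w w' => by
            change (u x).val (ofW₁ w + ofW₁ w') (one 𝒜) = _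
            rw [map_add]
            rfl
          map_smul' := fun c w => by
            change (u x).val (c • ofW₁ w) (one 𝒜) = _
            rw [map_smul]
            rfl }
      map_add' := fun x y => LinearMap.ext fun w => by
        change (u (x + y)).val (ofW₁ w) (one 𝒜) = _
        rw [map_add]
        rfl
      map_smul' := fun c x => LinearMap.ext fun w => by
        change (u (c • x)).val (ofW₁ w) (one 𝒜) = c • (u x).val (ofW₁ w) (one 𝒜)
        rw [hk, hval, hone, map_smul] }
  have hu' : ∀ x w, u' x w = (u x).val (ofW₁ w) (one 𝒜) := fun _ _ => rfl
  obtain ⟨s, hs⟩ := (f.hom.restrictScalars k).exists_leftInverse_of_injective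
    (LinearMap.ker_eq_bot.2 hf')
  have hs' : ∀ x, s (f x) = x := LinearMap.congr_fun hs
  -- Transpose the extension `u' ∘ s` back and average, to land among the bimodule maps. Averaging
  -- multiplies `A̲` on the left, so it commutes with the module structure, which comes from right
  -- multiplication.
  choose H hH using fun y : Y => D.exists_average (M := 𝒜.regular) (N := N)
    ((u' ∘ₗ s ∘ₗ (𝒜.rho y).restrictScalars k).flip)
  have hH' : ∀ (y : Y) w m, (H y).1 (ofW₁ w) m =
      ∑ i, ∑ j, ofR (D.e i) • u' (s (𝒜.rho y (ofR (D.e j) • m))) (mulW₁ (D.e i) w (D.e j)) := hH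
  let h : Y →ₗ[𝒜.Abar] RegularBimodHom N :=
    { toFun := H
      map_add' := fun y y' => BimodHom.ext_W₁ fun w m => by
        have : ∀ f g : 𝒜.BimodHom 𝒜.regular N, (f + g).1 (ofW₁ w) m =
          f.1 (ofW₁ w) m + g.1 (ofW₁ w) m := fun _ _ => rfl
        rw [hH']
        refine Eq.trans ?_ (this (H y) (H y')).symm
        rw [hH', hH']
        simp only [rho_add, map_add, LinearMap.add_apply, smul_add, Finset.sum_add_distrib]
      map_smul' := fun a y => BimodHom.ext_W₁ fun w m => by
        rw [hH']
        refine Eq.trans ?_ (hH' y w (𝒜.rmulBar a m)).symm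
        refine Finset.sum_congr rfl fun i _ => Finset.sum_congr rfl fun j _ => ?_
        rw [← rho_rmulBar_apply, FGMod.A_smul_def, FGMod.A_smul_def, map_smul (𝒜.rmulBar a)]
        rfl }
  refine ⟨ModuleCat.ofHom h, ModuleCat.hom_ext (LinearMap.ext fun x => ?_)⟩
  refine BimodHom.ext_W₁ fun w m => ?_
  refine (hH' (f x) w m).trans ?_
  -- On the image of `f` the map being averaged is `u x` itself, which averaging fixes.
  refine Eq.trans ?_ (D.average_apply (u x) w m)
  refine Finset.sum_congr rfl fun i _ => Finset.sum_congr rfl fun j _ => congrArg _ ?_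
  rw [← apply_rho f.hom x]
  change u' (s (f _)) _ = _
  rw [hs', hu']
  refine (hval (show 𝒜.Abar from ofR (D.e j) • m) x _ (one 𝒜)).trans ?_
  rw [rmulBar_one]
  rfl

end RegularBimodHom

namespace RegularBasis

variable {ι : Type} [Fintype ι] (D : 𝒜.RegularBasis ι)

/-- The map `Γ ⊗_{A̲} N ⟶ Hom_{A-A}(V, Hom_k(A̲, N))` of `A̲`-modules. -/
noncomputable def tensorΓToBimodHom (N : 𝒜.FGMod) :
    (ModuleCat.restrictScalars 𝒜.toΓ).obj (𝒜.tensorΓ.obj (ModuleCat.of 𝒜.Abar N)) ⟶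
      ModuleCat.of 𝒜.Abar (RegularBimodHom N) :=
  ModuleCat.ofHom
    (X := (ModuleCat.restrictScalars 𝒜.toΓ).obj (𝒜.tensorΓ.obj (ModuleCat.of 𝒜.Abar N)))
    { toFun := fun x => (Hom.f1 (tensorΓToF N x : Hom 𝒜.regular N) : 𝒜.BimodHom 𝒜.regular N)
      map_add' := fun x y => by
        have := map_add (tensorΓToF N).hom x y
        exact (congrArg (fun h : Hom 𝒜.regular N => h.f1) this)
      map_smul' := fun a x => by
        have h := map_smul (tensorΓToF N).hom (𝒜.toΓ a) x
        refine (congrArg (fun h : Hom 𝒜.regular N => h.f1) h).trans ?_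
        refine RegularBimodHom.ext fun v m => ?_
        exact Hom.ofLinear_comp_f1 (𝒜.rmulBar a) (tensorΓToF N x : Hom 𝒜.regular N) v m }

include D in
/-- The exact sequence `0 → N → Γ ⊗_{A̲} N → Hom_{A-A}(V, Hom_k(A̲, N)) → 0` of `A̲`-modules. -/
theorem exists_shortExact_unit (N : 𝒜.FGMod) :
    ∃ w : (extendScalarsFunctorAdj 𝒜.toΓ).unit.app (ModuleCat.of 𝒜.Abar N) ≫ tensorΓToBimodHom N = 0,
      (ShortComplex.mk _ _ w).ShortExact := by
  have hunit : ∀ n : N, tensorΓToF N ((extendScalarsFunctorAdj 𝒜.toΓ).unit.app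
      (ModuleCat.of 𝒜.Abar N) n) = (ofLinear (𝒜.rho n) : Hom 𝒜.regular N) := tensorΓToF_one_tmul
  refine ⟨ModuleCat.hom_ext (LinearMap.ext fun n =>
    congrArg (fun h : Hom 𝒜.regular N => h.f1) (hunit n)), { exact := ?_, mono_f := ?_, epi_g := ?_ }⟩
  · rw [ShortComplex.moduleCat_exact_iff]
    intro x hx
    let h : Hom 𝒜.regular N := tensorΓToF N x
    -- A morphism from `A̲` whose second component vanishes is `a ↦ a n` with `n` its value at `1`.
    refine ⟨(h.f0 (one 𝒜) : N), (D.bijective_tensorΓToF N).1 ?_⟩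
    refine (hunit (h.f0 (one 𝒜))).trans ?_
    exact Hom.regular_ext (h' := h) (rho_one (h.f0 (one 𝒜))) (Eq.symm hx)
  · refine (ModuleCat.mono_iff_injective _).2 fun n n' hn => ?_
    have h := (hunit n).symm.trans ((congrArg (tensorΓToF N) hn).trans (hunit n'))
    have h' : 𝒜.rho n (one 𝒜) = 𝒜.rho n' (one 𝒜) :=
      congrArg (fun h : Hom 𝒜.regular N => h.f0 (one 𝒜)) h
    rwa [rho_one, rho_one] at h'
  · refine (ModuleCat.epi_iff_surjective _).2 fun f => ?_
    obtain ⟨h, -, hf⟩ := exists_hom_regular (0 : N) f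
    obtain ⟨x, hx⟩ := (D.bijective_tensorΓToF N).2 h
    exact ⟨x, (congrArg (fun h : Hom 𝒜.regular N => h.f1) hx).trans hf⟩

include D in
theorem isEquivalence_lift_F :
    ∃ hF : ∀ M, 𝒜.induced (𝒜.F.obj M), (𝒜.induced.lift 𝒜.F hF).IsEquivalence := by
  have := faithful_F (𝒜 := 𝒜)
  have := D.full_F
  have hF : ∀ M, 𝒜.induced (𝒜.F.obj M) := fun M =>
    ⟨⟨ModuleCat.of 𝒜.Abar M, M.finite⟩, ⟨(D.tensorΓIso M).symm⟩⟩
  refine ⟨hF, { essSurj := ⟨fun X => ?_⟩ }⟩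
  obtain ⟨N, ⟨e⟩⟩ := X.property
  exact ⟨𝒜.L.obj N, ⟨𝒜.induced.isoMk (((D.tensorΓIso (𝒜.L.obj N)).symm) ≪≫ e.symm)⟩⟩

-- The abstract result produces an extension among all `A̲`-modules; its middle term is finitely
-- generated because both ends are.
include D in
theorem isClosedUnderExtensions_induced {ι' : Type} [Fintype ι'] (E : 𝒜.LayerIdempotents ι') :
    𝒜.induced.IsClosedUnderExtensions := by
  obtain ⟨_, _⟩ := D.exact_tensorΓ
  refine ⟨fun {S} hS ⟨N₁, ⟨e₁⟩⟩ ⟨N₃, ⟨e₃⟩⟩ => ?_⟩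
  have := RegularBimodHom.injective E (𝒜.L.obj N₁)
  obtain ⟨w, hw⟩ := D.exists_shortExact_unit (𝒜.L.obj N₁)
  obtain ⟨X, f, g, hfg, hX, ⟨e⟩⟩ := exists_shortExact_iso_map (extendScalarsFunctorAdj 𝒜.toΓ)
    (p := tensorΓToBimodHom (𝒜.L.obj N₁)) (w := w) hw hS e₁ e₃
  have h1 : Module.Finite 𝒜.Abar N₁.obj := N₁.property
  have h3 : Module.Finite 𝒜.Abar N₃.obj := N₃.property
  have hfin : Module.Finite 𝒜.Abar X := Module.Finite.of_exact (f := f.hom) (g := g.hom)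
    ((ShortComplex.ShortExact.moduleCat_exact_iff_function_exact _).1 hX.exact) hX.moduleCat_surjective_g
  exact ⟨⟨X, hfin⟩, ⟨e⟩⟩

-- Here `Ext` is formed in the categories of all modules, where the unit sequence has an injective
-- cokernel and projective presentations exist.
include D in
theorem mapExtAddHom_surjective_bijective {ι' : Type} [Fintype ι'] (E : 𝒜.LayerIdempotents ι') :
    ∃ (_ : Limits.PreservesFiniteLimits 𝒜.tensorΓ) (_ : Limits.PreservesFiniteColimits 𝒜.tensorΓ),
      ∀ (M N : FGModuleCat.{u} 𝒜.Abar) (n : ℕ),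
        (1 ≤ n → Function.Surjective (𝒜.tensorΓ.mapExtAddHom M.obj N.obj n)) ∧
        (2 ≤ n → Function.Bijective (𝒜.tensorΓ.mapExtAddHom M.obj N.obj n)) := by
  obtain ⟨h1, h2⟩ := D.exact_tensorΓ
  refine ⟨h1, h2, fun M N n => ?_⟩
  have := RegularBimodHom.injective E (𝒜.L.obj N)
  obtain ⟨w, hw⟩ := D.exists_shortExact_unit (𝒜.L.obj N)
  have hs : ∀ n, Function.Surjective (𝒜.tensorΓ.mapExtAddHom M.obj N.obj (n + 1)) :=
    mapExtAddHom_surjective_of_injective_cokernel (extendScalarsFunctorAdj 𝒜.toΓ)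
      (p := tensorΓToBimodHom (𝒜.L.obj N)) (w := w) hw M.obj
  have hi : ∀ n, Function.Injective (𝒜.tensorΓ.mapExtAddHom M.obj N.obj (n + 2)) :=
    mapExtAddHom_injective_of_injective_cokernel (extendScalarsFunctorAdj 𝒜.toΓ)
      (p := tensorΓToBimodHom (𝒜.L.obj N)) (w := w) hw M.obj
  refine ⟨fun hn => ?_, fun hn => ?_⟩
  · obtain ⟨n, rfl⟩ := Nat.exists_eq_add_of_le' hn
    exact hs n
  · obtain ⟨n, rfl⟩ := Nat.exists_eq_add_of_le' hn
    exact ⟨hi n, hs (n + 1)⟩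

end RegularBasis

end InterlacedWeakDitalgebra

theorem mainTheorem7 {k : Type u} [Field k] [IsAlgClosed k] (𝒜 : InterlacedWeakDitalgebra k)
    (h𝒜 : 𝒜.IsSpecial) :
    -- (1) `F` is a full and faithful exact functor from `𝒜-mod` to `Γ-mod`
    (∃ hF : ∀ M, ModuleCat.isFG 𝒜.Γ (𝒜.F.obj M),
      ((ModuleCat.isFG 𝒜.Γ).lift 𝒜.F hF).Full ∧ ((ModuleCat.isFG 𝒜.Γ).lift 𝒜.F hF).Faithful ∧
      ∀ {M E N : 𝒜.FGMod} (f : M ⟶ E) (g : E ⟶ N), InterlacedWeakDitalgebra.IsConflation f g →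
        ∃ w : 𝒜.F.map f ≫ 𝒜.F.map g = 0,
          (ShortComplex.mk (𝒜.F.map f) (𝒜.F.map g) w).ShortExact) ∧
    -- (2) `Γ ⊗ -` is exact, maps `A̲-mod` to `Γ-mod`, and is isomorphic to `F L` there
    (Limits.PreservesFiniteLimits 𝒜.tensorΓ ∧
      Limits.PreservesFiniteColimits 𝒜.tensorΓ ∧
      (∀ M : FGModuleCat.{u} 𝒜.Abar, ModuleCat.isFG 𝒜.Γ (𝒜.tensorΓ.obj M.obj)) ∧
      Nonempty ((ModuleCat.isFG 𝒜.Abar).ι ⋙ 𝒜.tensorΓ ≅ 𝒜.L ⋙ 𝒜.F)) ∧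
    -- (3) `F` restricts to an equivalence onto `ℐ`, and `ℐ` is closed under extensions
    ((∃ hF : ∀ M, 𝒜.induced (𝒜.F.obj M), (𝒜.induced.lift 𝒜.F hF).IsEquivalence) ∧
      𝒜.induced.IsClosedUnderExtensions) ∧
    -- (4) the maps induced by `Γ ⊗ -` on `Ext`
    (∃ (_ : Limits.PreservesFiniteLimits 𝒜.tensorΓ)
      (_ : Limits.PreservesFiniteColimits 𝒜.tensorΓ),
      ∀ (M N : FGModuleCat.{u} 𝒜.Abar) (n : ℕ),
        (1 ≤ n → Function.Surjective (𝒜.tensorΓ.mapExtAddHom M.obj N.obj n)) ∧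
        (2 ≤ n → Function.Bijective (𝒜.tensorΓ.mapExtAddHom M.obj N.obj n))) := by
  obtain ⟨ι, _, ⟨D⟩⟩ := InterlacedWeakDitalgebra.exists_regularBasis h𝒜
  obtain ⟨n, ⟨φ⟩⟩ := h𝒜.layer_eq
  obtain ⟨E⟩ := InterlacedWeakDitalgebra.exists_layerIdempotents φ
  have := D.full_F
  have := InterlacedWeakDitalgebra.RegularBasis.faithful_F (𝒜 := 𝒜)
  refine ⟨⟨D.finite_F, inferInstance, inferInstance, D.shortExact_F⟩,
    ⟨D.exact_tensorΓ.1, D.exact_tensorΓ.2, fun M => ?_, ⟨D.tensorΓNatIso⟩⟩,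
    ⟨D.isEquivalence_lift_F, D.isClosedUnderExtensions_induced E⟩,
    D.mapExtAddHom_surjective_bijective E⟩
  have : Module.Finite 𝒜.Abar M.obj := M.property
  exact extendScalarsFunctor_finite 𝒜.toΓ
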